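/- Let $p$ be a prime and put $\mathbf p=4$ if $p=2$ and $\mathbf p=p$ if $p$ is odd. Let $D$ be an associative unital $\mathbb Z_p$-algebra without $\mathbb Z_p$-torsion such that $\bigcap_i p^iD=0$ and $D$ is complete in the topology induced by the filtration $(p^iD)_i$; all limits and infinite sums below are taken in this topology. For $a\in D$ write $e^a=\sum_{n\ge 0}a^n/n!$ and $\log(1+a)=\sum_{n\ge 1}(-1)^{n+1}a^n/n$, whenever the terms of the series lie in $D$ and the series converges in $D$. Let $H(x_1,x_2)=\log(e^{x_1}e^{x_2})=\sum_{n\ge1}H_n(x_1,x_2)$ be the Baker-Campbell-Hausdorff series in two non-commuting variables, $H_n$ being its homogeneous component of degree $n$, which is a Lie word in $x_1,x_2$ with rational coefficients. For a torsion-free Lie $\mathbb Z_p$-algebra $M$ that is separated and complete for the filtration $(p^iM)_i$, let $\Gamma(\mathbf pM)$ be the set $\mathbf pM$ with the multiplication $(a,b)\mapsto H(a,b)=\sum_n H_n(a,b)$ (the Lie words $H_n$ are evaluated in $\mathbb Q_p\otimes_{\mathbb Z_p} M\supseteq M$, their values at $a,b\in\mathbf pM$ lie in $M$, and the sum converges in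 the topology of the filtration $(p^iM)_i$). Let $D^{(-)}$ be $D$ with the Lie bracket $[u,v]=uv-vu$. Then: (i) If $a\in\mathbf pD$, then $a^n/n!\in\mathbf pD$ for all $n\ge1$ and $\lim_{n\to\infty}a^n/n!=0$; moreover $e^a$ is defined and lies in $1+\mathbf pD$, and $\log(1+a)$ is defined and lies in $\mathbf pD$. (ii) If $a\in\mathbf pD$, then $\log(e^a)=a$ and $e^{\log(1+a)}=1+a$; in particular, $e^a=1$ if and only if $a=0$. (iii) If $M$ is a Lie $\mathbb Z_p$-subalgebra of $D^{(-)}$ that is closed in $D$, then $\Gamma(\mathbf pM)$ is a group, $\{e^a\mid a\in\mathbf pM\}$ is a group under the multiplication of $D$ (a subgroup of $D^\times$), and $a\mapsto e^a$ is an isomorphism from $\Gamma(\mathbf pM)$ onto it. -/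

import Mathlib

open scoped TensorProduct
open Filter

/- An associative ring is a Lie ring under the commutator `[u, v] = u * v - v * u`. -/
attribute [local instance 100] LieRing.ofAssociativeRing

noncomputable section

/-- The number `𝐩 = 𝐩(p)`: it is `4` for `p = 2` and `p` for odd `p`. -/
def boldP (p : ℕ) : ℕ := if p = 2 then 4 else p

/-- The submodule `𝐩L = {𝐩 y | y ∈ L}` of a `ℤ_p`-module `L`. -/
def boldPMul (p : ℕ) [Fact p.Prime] (L : Type*) [AddCommGroup L] [Module ℤ_[p] L] :
    Submodule ℤ_[p] L :=
  LinearMap.range (LinearMap.lsmul ℤ_[p] L (boldP p : ℤ_[p]))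

/-- The `p`-adic topology of a `ℤ_p`-module `L`: the submodules `p^i L` are a basis of
neighbourhoods of `0`. -/
abbrev padicTop (p : ℕ) [Fact p.Prime] (L : Type*) [AddCommGroup L] [Module ℤ_[p] L] :
    TopologicalSpace L :=
  (Ideal.span {(p : ℤ_[p])}).adicModuleTopology L

/-- The sequence `u` converges to `x` in the `p`-adic topology of `L`. -/
def PadicTendsto (p : ℕ) [Fact p.Prime] {L : Type*} [AddCommGroup L] [Module ℤ_[p] L]
    (u : ℕ → L) (x : L) : Prop :=
  Tendsto u atTop (@nhds L (padicTop p L) x)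

/-- The series `∑ n, t n` converges to `s` in the `p`-adic topology of `L`. -/
def HasPadicSum (p : ℕ) [Fact p.Prime] {L : Type*} [AddCommGroup L] [Module ℤ_[p] L]
    (t : ℕ → L) (s : L) : Prop :=
  PadicTendsto p (fun N => ∑ n ∈ Finset.range N, t n) s

/-- `t n = a ^ n / n!` for all `n` (in a torsion-free ring such a `t n` is unique). -/
def IsExpTerms {D : Type*} [Ring D] (a : D) (t : ℕ → D) : Prop :=
  ∀ n, n.factorial • t n = a ^ n

/-- `t n = (-1) ^ n * a ^ (n + 1) / (n + 1)` for all `n`: the terms of the series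
`log (1 + a) = a - a ^ 2 / 2 + a ^ 3 / 3 - ⋯`. -/
def IsLogTerms {D : Type*} [Ring D] (a : D) (t : ℕ → D) : Prop :=
  ∀ n, (n + 1) • t n = (-1) ^ n * a ^ (n + 1)

/-- `e ^ a` is defined (the terms `a ^ n / n!` exist in `D` and their series converges
`p`-adically) and is equal to `u`. -/
def IsExp (p : ℕ) [Fact p.Prime] {D : Type*} [Ring D] [Algebra ℤ_[p] D] (a u : D) : Prop :=
  ∃ t : ℕ → D, IsExpTerms a t ∧ HasPadicSum p t u

/-- `log u` is defined (the terms of the series at `a = u - 1` exist in `D` and their series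
converges `p`-adically) and is equal to `v`. -/
def IsLog (p : ℕ) [Fact p.Prime] {D : Type*} [Ring D] [Algebra ℤ_[p] D] (u v : D) : Prop :=
  ∃ t : ℕ → D, IsLogTerms (u - 1) t ∧ HasPadicSum p t v

/-- The formal series `e ^ (t x) = ∑ n, (x ^ n / n!) t ^ n` in a central variable `t`. -/
def formalExp (K : Type*) [Field K] {A : Type*} [Ring A] [Algebra K A] (x : A) :
    PowerSeries A :=
  PowerSeries.mk fun n => ((n.factorial : K)⁻¹) • x ^ n

/-- The homogeneous component `H_n(x₁, x₂)` of degree `n` of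
`H(x₁, x₂) = log (e ^ x₁ * e ^ x₂)`, an element of the free associative algebra on `x₁, x₂`.
The central variable `t` of `formalExp` records the degree, so `H_n(x₁, x₂)` is the coefficient
of `t ^ n` in `log (e ^ (t x₁) * e ^ (t x₂)) = ∑ k ≥ 1, (-1) ^ (k + 1) / k * f ^ k` with
`f = e ^ (t x₁) * e ^ (t x₂) - 1`; since `t` divides `f`, only `k ≤ n` contribute. -/
def bchComponent (K : Type*) [Field K] (n : ℕ) : FreeAlgebra K (Fin 2) :=
  ∑ k ∈ Finset.Icc 1 n, ((-1) ^ (k + 1) / (k : K)) •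
    PowerSeries.coeff n
      ((formalExp K (FreeAlgebra.ι K (0 : Fin 2)) * formalExp K (FreeAlgebra.ι K (1 : Fin 2))
        - 1) ^ k)

/-- The element of the free associative algebra given by a Lie word in `x₁, x₂`
(where `[u, v] = u * v - v * u`). -/
def lieWordToAssoc (K : Type*) [Field K] :
    FreeLieAlgebra K (Fin 2) →ₗ⁅K⁆ FreeAlgebra K (Fin 2) :=
  FreeLieAlgebra.lift K (FreeAlgebra.ι K)

/-- The value at `x₁ = a`, `x₂ = b` of a Lie word with coefficients in `ℚ_p`, for elements `a`, `b`
of a Lie `ℤ_p`-algebra `L`; it lies in `ℚ_p ⊗ L`. -/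
def evalLieWord (p : ℕ) [Fact p.Prime] {L : Type*} [LieRing L] [LieAlgebra ℤ_[p] L]
    (a b : L) : FreeLieAlgebra ℚ_[p] (Fin 2) →ₗ⁅ℚ_[p]⁆ ℚ_[p] ⊗[ℤ_[p]] L :=
  FreeLieAlgebra.lift ℚ_[p] ![(1 : ℚ_[p]) ⊗ₜ[ℤ_[p]] a, (1 : ℚ_[p]) ⊗ₜ[ℤ_[p]] b]

/-- `H_n(a, b) = c` in a (torsion-free) Lie `ℤ_p`-algebra `L`: `H_n` is given by a Lie word `w`,
and the value of `w` at `a, b`, computed in `ℚ_p ⊗ L`, is the element `c` of `L`. -/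
def IsBCHTerm (p : ℕ) [Fact p.Prime] {L : Type*} [LieRing L] [LieAlgebra ℤ_[p] L]
    (n : ℕ) (a b c : L) : Prop :=
  ∃ w : FreeLieAlgebra ℚ_[p] (Fin 2),
    lieWordToAssoc ℚ_[p] w = bchComponent ℚ_[p] n ∧
      evalLieWord p a b w = (1 : ℚ_[p]) ⊗ₜ[ℤ_[p]] c

/-- `H(a, b) = c`: all the `H_n(a, b)` lie in `L`, and `∑ n, H_n(a, b)` converges to `c` in the
`p`-adic topology of `L`. -/
def IsBCH (p : ℕ) [Fact p.Prime] {L : Type*} [LieRing L] [LieAlgebra ℤ_[p] L]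
    (a b c : L) : Prop :=
  ∃ h : ℕ → L, (∀ n, IsBCHTerm p n a b (h n)) ∧ HasPadicSum p h c

/-- The group structure `G` on `𝐩L` is that of `Γ(𝐩L) = (𝐩L, H)`: its multiplication is `H`. -/
def IsBCHGroup (p : ℕ) [Fact p.Prime] (L : Type*) [LieRing L] [LieAlgebra ℤ_[p] L]
    (G : Group (boldPMul p L)) : Prop :=
  ∀ a b : boldPMul p L, IsBCH p (a : L) (b : L) ((G.mul a b : boldPMul p L) : L)

end

/-! ### Formal composition of power series with non-commuting coefficients -/

section FormalComposition

open PowerSeries Finset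

/-! Embed `D` in `A = ℚ_p ⊗ D` and attach a central variable `t` to the elements of `D`. In `A[[t]]`
the identities `log (e ^ f) = f`, `e ^ (log (1 + f)) = 1 + f` and, for commuting `f` and `g`, `e ^
(f + g) = e ^ f * e ^ g` are formal (`logOneAdd_expOf`, `expOf_logOneAdd`, `expOf_add`). Setting `t
= 1` (`HasEval`) carries them to `D`.

Convergence rests on one class of series (`HasSmallDenoms`): the coefficient of `t ^ n` lies in `p ^
(-s) 𝐩 ^ n D` with `s (p - 1) ≤ n - 1`. As `1 / n` and `1 / n!` have denominators of this size, the
class is stable under sums, products, `e ^ f - 1` and `log (1 + f)`. By the choice of `𝐩`, the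
number `𝐩 ^ n / p ^ s` lies in `𝐩 ℤ_p` and tends to `0` (`exponent_bounds`), so every series of the
class has a value in `𝐩D`. An exchange of summations (`HasEval.ncSubst`) shows that the value of a
composite series is the composite of the values. This gives (i) and (ii).

For (iii) the values of `H_n` must be integral in `M`, not only in `D`. This follows from Dynkin's
formula: `n H_n` is the image of `H_n` under the right-normed bracket map. To prove it, let the
variables act by commutators. Left and right multiplications commute, so `H_n` acts as the
commutator with `H_n` (`adLift_bchComponent`); acting on minus the degree derivation then yields the
formula (`dynkin_bchComponent`). The bracket map sends words of length `n` in elements of `𝐩M` into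
`𝐩 ^ n M`, which absorbs the denominators of `H_n` and the factor `1 / n`. A closed `M` is complete
for its own filtration, so `H(a, b)` exists in `𝐩M`, and `e ^ H(a, b) = e ^ a * e ^ b`. The
exponentials thus form a subgroup of the units, whose structure is pulled back to `𝐩M`. -/

theorem sum_range_antidiagonal_eq {M : Type*} [AddCommMonoid M] (F : ℕ × ℕ → M) (N : ℕ)
    (h : ∀ i j, N ≤ i + j → F (i, j) = 0) :
    ∑ k ∈ range N, ∑ x ∈ antidiagonal k, F x = ∑ i ∈ range N, ∑ j ∈ range N, F (i, j) := by
  rw [← Finset.sum_product', Finset.sum_sigma']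
  refine Finset.sum_of_injOn (fun x => x.2) ?_ ?_ ?_ ?_
  · rintro ⟨a, b⟩ h1 ⟨c, d⟩ h2 (h3 : b = d)
    simp only [coe_sigma, Set.mem_sigma_iff, mem_coe, mem_range,
      Finset.HasAntidiagonal.mem_antidiagonal] at h1 h2
    subst h3
    obtain rfl : a = c := by omega
    rfl
  · rintro ⟨a, b, c⟩ h1
    simp only [coe_sigma, Set.mem_sigma_iff, mem_coe, mem_range,
      Finset.HasAntidiagonal.mem_antidiagonal] at h1
    simp only [mem_coe, mem_product, mem_range]
    omega
  · rintro ⟨i, j⟩ - h2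
    apply h
    by_contra hlt
    exact h2 ⟨⟨i + j, (i, j)⟩, by simpa using hlt, rfl⟩
  · intros; rfl

variable {K C : Type*} [CommRing K] [Ring C] [Algebra K C]

/-- The composite `∑ k, g_k f ^ k` of a power series `g` with a power series `f` without constant
term, whose coefficients need not commute. -/
noncomputable def ncSubst (g : PowerSeries K) (f : PowerSeries C) : PowerSeries C :=
  PowerSeries.mk fun n => ∑ k ∈ range (n + 1), coeff k g • coeff n (f ^ k)

theorem coeff_pow_eq_zero_of_lt {f : PowerSeries C} (hf : constantCoeff f = 0) {n k : ℕ}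
    (h : n < k) : coeff n (f ^ k) = 0 :=
  coeff_of_lt_order _ (lt_of_lt_of_le (by exact_mod_cast h)
    (le_order_pow_of_constantCoeff_eq_zero k hf))

theorem coeff_ncSubst (g : PowerSeries K) {f : PowerSeries C} (hf : constantCoeff f = 0)
    {n N : ℕ} (h : n < N) :
    coeff n (ncSubst g f) = ∑ k ∈ range N, coeff k g • coeff n (f ^ k) := by
  rw [ncSubst, coeff_mk]
  refine Finset.sum_subset (by intro x; simp; omega) fun k _ hk => ?_
  rw [coeff_pow_eq_zero_of_lt hf (by simpa using hk), smul_zero]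

theorem ncSubst_add (g h : PowerSeries K) (f : PowerSeries C) :
    ncSubst (g + h) f = ncSubst g f + ncSubst h f := by
  ext n
  simp [ncSubst, add_smul, Finset.sum_add_distrib]

theorem ncSubst_sub (g h : PowerSeries K) (f : PowerSeries C) :
    ncSubst (g - h) f = ncSubst g f - ncSubst h f := by
  ext n
  simp [ncSubst, sub_smul, Finset.sum_sub_distrib]

theorem ncSubst_one (f : PowerSeries C) : ncSubst (1 : PowerSeries K) f = 1 := by
  ext n
  simp [ncSubst, PowerSeries.coeff_one, ite_smul]

theorem ncSubst_X {f : PowerSeries C} (hf : constantCoeff f = 0) :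
    ncSubst (X : PowerSeries K) f = f := by
  ext n
  rw [coeff_ncSubst _ hf (show n < n + 2 by omega),
    Finset.sum_eq_single_of_mem 1 (by simp) (by intro b _ hb; simp [PowerSeries.coeff_X, hb])]
  simp

theorem constantCoeff_ncSubst (g : PowerSeries K) (f : PowerSeries C) :
    constantCoeff (ncSubst g f) = constantCoeff g • (1 : C) := by
  rw [← coeff_zero_eq_constantCoeff_apply, ncSubst, coeff_mk]
  simp

/-- Only powers of the single series `f` and central scalars occur, so non-commutativity of the
coefficients does no harm. All sums can be cut at `n` because `f ^ k` has order at least `k`. -/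
theorem ncSubst_mul (g h : PowerSeries K) {f : PowerSeries C} (hf : constantCoeff f = 0) :
    ncSubst (g * h) f = ncSubst g f * ncSubst h f := by
  ext n
  rw [coeff_ncSubst _ hf (Nat.lt_succ_self n), PowerSeries.coeff_mul]
  have h1 : ∀ x ∈ antidiagonal n, coeff x.1 (ncSubst g f) * coeff x.2 (ncSubst h f) =
      ∑ i ∈ range (n + 1), ∑ j ∈ range (n + 1),
        (coeff i g * coeff j h) • (coeff x.1 (f ^ i) * coeff x.2 (f ^ j)) := by
    intro x hx
    rw [Finset.HasAntidiagonal.mem_antidiagonal] at hx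
    rw [coeff_ncSubst _ hf (show x.1 < n + 1 by omega),
      coeff_ncSubst _ hf (show x.2 < n + 1 by omega), Finset.sum_mul_sum]
    simp only [smul_mul_smul_comm]
  rw [Finset.sum_congr rfl h1, Finset.sum_comm]
  have h2 : ∀ i ∈ range (n + 1), ∑ x ∈ antidiagonal n, ∑ j ∈ range (n + 1),
      (coeff i g * coeff j h) • (coeff x.1 (f ^ i) * coeff x.2 (f ^ j)) =
      ∑ j ∈ range (n + 1), (coeff i g * coeff j h) • coeff n (f ^ (i + j)) := by
    intro i _
    rw [Finset.sum_comm]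
    refine Finset.sum_congr rfl fun j _ => ?_
    rw [pow_add, PowerSeries.coeff_mul, Finset.smul_sum]
  rw [Finset.sum_congr rfl h2, ← sum_range_antidiagonal_eq
    (fun x => (coeff x.1 g * coeff x.2 h) • coeff n (f ^ (x.1 + x.2))) (n + 1)]
  · refine Finset.sum_congr rfl fun k _ => ?_
    rw [PowerSeries.coeff_mul, Finset.sum_smul]
    refine Finset.sum_congr rfl fun x hx => ?_
    rw [Finset.HasAntidiagonal.mem_antidiagonal.1 hx]
  · intro i j hij
    simp only
    rw [coeff_pow_eq_zero_of_lt hf (by omega), smul_zero]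

theorem ncSubst_pow (g : PowerSeries K) {f : PowerSeries C} (hf : constantCoeff f = 0) (k : ℕ) :
    ncSubst (g ^ k) f = ncSubst g f ^ k := by
  induction k with
  | zero => simp [ncSubst_one]
  | succ k ih => rw [pow_succ, ncSubst_mul _ _ hf, ih, pow_succ]

theorem ncSubst_ncSubst (g : PowerSeries K) {h : PowerSeries K} {f : PowerSeries C}
    (hh : constantCoeff h = 0) (hf : constantCoeff f = 0) :
    ncSubst g (ncSubst h f) = ncSubst (ncSubst g h) f := by
  ext n
  rw [coeff_ncSubst _ (by rw [constantCoeff_ncSubst, hh, zero_smul]) (Nat.lt_succ_self n),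
    coeff_ncSubst _ hf (Nat.lt_succ_self n)]
  simp only [← ncSubst_pow _ hf, coeff_ncSubst _ hf (Nat.lt_succ_self n)]
  have : ∀ j ∈ range (n + 1), coeff j (ncSubst g h) • coeff n (f ^ j) =
      ∑ k ∈ range (n + 1), (coeff k g * coeff j (h ^ k)) • coeff n (f ^ j) := by
    intro j hj
    rw [coeff_ncSubst _ hh (Finset.mem_range.1 hj), Finset.sum_smul]
    rfl
  rw [Finset.sum_congr rfl this, Finset.sum_comm]
  refine Finset.sum_congr rfl fun k _ => ?_
  rw [Finset.smul_sum]
  simp only [mul_smul]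

theorem map_ncSubst {C' : Type*} [Ring C'] [Algebra K C'] (ψ : C →ₐ[K] C') (g : PowerSeries K)
    (f : PowerSeries C) :
    PowerSeries.map (ψ : C →+* C') (ncSubst g f) =
      ncSubst g (PowerSeries.map (ψ : C →+* C') f) := by
  ext n
  simp [ncSubst, ← map_pow, PowerSeries.coeff_map]

theorem Commute.ncSubst_right {f f' : PowerSeries C} (h : Commute f' f) (hf : constantCoeff f = 0)
    (g : PowerSeries K) : Commute f' (ncSubst g f) := by
  have key : ∀ k, f' * f ^ k = f ^ k * f' := fun k => h.pow_right k
  ext n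
  have h1 : ∀ x ∈ antidiagonal n, coeff x.1 f' * coeff x.2 (ncSubst g f) =
      ∑ k ∈ range (n + 1), coeff k g • (coeff x.1 f' * coeff x.2 (f ^ k)) := by
    intro x hx
    rw [Finset.HasAntidiagonal.mem_antidiagonal] at hx
    rw [coeff_ncSubst _ hf (show x.2 < n + 1 by omega), Finset.mul_sum]
    simp only [mul_smul_comm]
  have h2 : ∀ x ∈ antidiagonal n, coeff x.1 (ncSubst g f) * coeff x.2 f' =
      ∑ k ∈ range (n + 1), coeff k g • (coeff x.1 (f ^ k) * coeff x.2 f') := by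
    intro x hx
    rw [Finset.HasAntidiagonal.mem_antidiagonal] at hx
    rw [coeff_ncSubst _ hf (show x.1 < n + 1 by omega), Finset.sum_mul]
    simp only [smul_mul_assoc]
  rw [PowerSeries.coeff_mul, PowerSeries.coeff_mul, Finset.sum_congr rfl h1,
    Finset.sum_congr rfl h2, Finset.sum_comm, Finset.sum_comm (s := antidiagonal n)]
  refine Finset.sum_congr rfl fun k _ => ?_
  rw [← Finset.smul_sum, ← Finset.smul_sum, ← PowerSeries.coeff_mul, ← PowerSeries.coeff_mul, key]

end FormalComposition

/-! ### The exponential and logarithmic series -/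

section ExpLog

open PowerSeries Finset

variable (K : Type*) {C : Type*} [Field K] [Ring C] [Algebra K C]

theorem derivative_ncSubst (g : PowerSeries K) {f : PowerSeries K} (hf : constantCoeff f = 0) :
    derivative K (ncSubst g f) = ncSubst (derivative K g) f * derivative K f := by
  ext n
  have h1 : ∀ x ∈ antidiagonal n, coeff x.1 (ncSubst (derivative K g) f) *
      coeff x.2 (derivative K f) = ∑ k ∈ range (n + 1), (coeff (k + 1) g * (k + 1)) *
        (coeff x.1 (f ^ k) * coeff x.2 (derivative K f)) := by
    intro x hx
    rw [Finset.HasAntidiagonal.mem_antidiagonal] at hx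
    rw [coeff_ncSubst _ hf (show x.1 < n + 1 by omega), Finset.sum_mul]
    simp only [smul_eq_mul, coeff_derivative, mul_assoc]
  rw [coeff_derivative, coeff_ncSubst _ hf (Nat.lt_succ_self (n + 1)), Finset.sum_range_succ',
    PowerSeries.coeff_mul, Finset.sum_congr rfl h1, Finset.sum_comm, add_mul, Finset.sum_mul]
  simp only [pow_zero, PowerSeries.coeff_one, Nat.succ_ne_zero, if_false, smul_zero, zero_mul,
    add_zero]
  refine Finset.sum_congr rfl fun k _ => ?_
  rw [← Finset.mul_sum, ← PowerSeries.coeff_mul, smul_eq_mul, mul_assoc, ← coeff_derivative,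
    PowerSeries.derivative_pow, mul_assoc, ← Nat.cast_succ, mul_assoc]
  rw [show (((k + 1 : ℕ) : PowerSeries K)) = PowerSeries.C ((k + 1 : ℕ) : K) by simp,
    PowerSeries.coeff_C_mul]
  simp

theorem map_formalExp {C' : Type*} [Ring C'] [Algebra K C'] (ψ : C →ₐ[K] C') (x : C) :
    PowerSeries.map (ψ : C →+* C') (formalExp K x) = formalExp K (ψ x) := by
  ext n
  simp [formalExp, PowerSeries.coeff_map]

theorem constantCoeff_formalExp (x : C) : constantCoeff (formalExp K x) = 1 := by
  rw [← coeff_zero_eq_constantCoeff_apply, formalExp, coeff_mk]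
  simp

variable [CharZero K]

/-- The series `e ^ X - 1`. -/
noncomputable def expSubOne : PowerSeries K := PowerSeries.exp K - 1

theorem coeff_exp' (n : ℕ) : coeff n (PowerSeries.exp K) = (n.factorial : K)⁻¹ := by
  simp [PowerSeries.coeff_exp]

theorem constantCoeff_expSubOne : constantCoeff (expSubOne K) = 0 := by simp [expSubOne]

theorem coeff_log' (n : ℕ) : coeff n (PowerSeries.log K) = (-1) ^ (n + 1) / (n : K) := by
  rw [PowerSeries.coeff_log]
  split_ifs with h <;> simp [h]

theorem one_add_X_mul_derivative_log :
    (1 + X) * derivative K (PowerSeries.log K) = 1 := by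
  rw [PowerSeries.deriv_log]
  ext n
  cases n with
  | zero => simp
  | succ n => simp [add_mul, PowerSeries.coeff_succ_X_mul, pow_succ, PowerSeries.coeff_one]

/-- Both sides have constant term `0` and derivative `1`: substitute `e ^ X - 1` for `X` in `(1 + X)
log' = 1`. -/
theorem ncSubst_log_expSubOne : ncSubst (PowerSeries.log K) (expSubOne K) = X := by
  have h0 := constantCoeff_expSubOne K
  refine PowerSeries.derivative.ext ?_ ?_
  · rw [derivative_ncSubst K _ h0, derivative_X]
    have h1 : derivative K (expSubOne K) = 1 + expSubOne K := by
      simp [expSubOne, PowerSeries.derivative_exp]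
    rw [h1, mul_comm]
    have h2 := congrArg (fun g => ncSubst g (expSubOne K)) (one_add_X_mul_derivative_log K)
    simpa [ncSubst_mul _ _ h0, ncSubst_add, ncSubst_one, ncSubst_X h0] using h2
  · rw [constantCoeff_ncSubst]; simp

/-- The composite `F` solves `(1 + X) F' = F`, that is `(n + 1) F_{n+1} = (1 - n) F_n`. The factor
`1 - n` vanishes at `n = 1`, so the series stops after the linear term. -/
theorem ncSubst_exp_log : ncSubst (PowerSeries.exp K) (PowerSeries.log K) = 1 + X := by
  have h0 : constantCoeff (PowerSeries.log K) = 0 := by simp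
  set F := ncSubst (PowerSeries.exp K) (PowerSeries.log K) with hF
  have h1 : (1 + X) * derivative K F = F := by
    rw [hF, derivative_ncSubst K _ h0, PowerSeries.derivative_exp, mul_left_comm,
      one_add_X_mul_derivative_log, mul_one]
  have h2 : ∀ n, coeff (n + 1) F * (n + 1) = coeff n F * (1 - n) := by
    intro n
    have h3 := congrArg (coeff n) h1
    rw [add_mul, one_mul, map_add, coeff_derivative] at h3
    cases n with
    | zero => simpa using h3
    | succ n =>
      rw [PowerSeries.coeff_succ_X_mul, coeff_derivative] at h3
      push_cast at h3 ⊢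
      linear_combination h3
  have h3 : coeff 0 F = 1 := by
    rw [coeff_zero_eq_constantCoeff_apply, hF, constantCoeff_ncSubst]; simp
  have h4 : coeff 1 F = 1 := by simpa [h3] using h2 0
  have h5 : ∀ n, coeff (n + 2) F = 0 := by
    intro n
    induction n with
    | zero =>
      have h6 := h2 1
      norm_num at h6
      exact h6
    | succ n ih =>
      have h6 := h2 (n + 2)
      rw [ih, zero_mul] at h6
      exact (mul_eq_zero.1 h6).resolve_right (by exact_mod_cast Nat.succ_ne_zero (n + 2))
  ext n
  match n with
  | 0 => simp only [h3]; simp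
  | 1 => simp only [h4]; simp [PowerSeries.coeff_one]
  | n + 2 => simp only [h5]; simp [PowerSeries.coeff_one, PowerSeries.coeff_X]

/-- The formal logarithm `log (1 + f)`. -/
noncomputable def logOneAdd (f : PowerSeries C) : PowerSeries C := ncSubst (PowerSeries.log K) f

/-- The formal exponential `e ^ f`. -/
noncomputable def expOf (f : PowerSeries C) : PowerSeries C := ncSubst (PowerSeries.exp K) f

theorem constantCoeff_logOneAdd (f : PowerSeries C) : constantCoeff (logOneAdd K f) = 0 := by
  simp [logOneAdd, constantCoeff_ncSubst]

theorem expOf_eq (f : PowerSeries C) : expOf K f = 1 + ncSubst (expSubOne K) f := by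
  rw [expSubOne, ncSubst_sub, ncSubst_one, expOf]; abel

theorem expOf_logOneAdd {f : PowerSeries C} (hf : constantCoeff f = 0) :
    expOf K (logOneAdd K f) = 1 + f := by
  rw [expOf, logOneAdd, ncSubst_ncSubst _ (by simp) hf, ncSubst_exp_log, ncSubst_add, ncSubst_one,
    ncSubst_X hf]

theorem logOneAdd_expOf {f : PowerSeries C} (hf : constantCoeff f = 0) :
    logOneAdd K (expOf K f - 1) = f := by
  rw [expOf_eq, add_sub_cancel_left, logOneAdd, ncSubst_ncSubst _ (constantCoeff_expSubOne K) hf,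
    ncSubst_log_expSubOne, ncSubst_X hf]

theorem expOf_add {f g : PowerSeries C} (hf : constantCoeff f = 0) (hg : constantCoeff g = 0)
    (hfg : Commute f g) : expOf K (f + g) = expOf K f * expOf K g := by
  have hs : constantCoeff (f + g) = 0 := by simp [hf, hg]
  ext n
  rw [expOf, coeff_ncSubst _ hs (Nat.lt_succ_self n), PowerSeries.coeff_mul]
  have h1 : ∀ x ∈ antidiagonal n, coeff x.1 (expOf K f) * coeff x.2 (expOf K g) =
      ∑ i ∈ range (n + 1), ∑ j ∈ range (n + 1),
        ((i.factorial : K)⁻¹ * (j.factorial : K)⁻¹) • (coeff x.1 (f ^ i) * coeff x.2 (g ^ j)) := by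
    intro x hx
    rw [Finset.HasAntidiagonal.mem_antidiagonal] at hx
    rw [expOf, expOf, coeff_ncSubst _ hf (show x.1 < n + 1 by omega),
      coeff_ncSubst _ hg (show x.2 < n + 1 by omega), Finset.sum_mul_sum]
    simp only [smul_mul_smul_comm, coeff_exp']
  rw [Finset.sum_congr rfl h1, Finset.sum_comm]
  have h2 : ∀ i ∈ range (n + 1), ∑ x ∈ antidiagonal n, ∑ j ∈ range (n + 1),
      ((i.factorial : K)⁻¹ * (j.factorial : K)⁻¹) • (coeff x.1 (f ^ i) * coeff x.2 (g ^ j)) =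
      ∑ j ∈ range (n + 1),
        ((i.factorial : K)⁻¹ * (j.factorial : K)⁻¹) • coeff n (f ^ i * g ^ j) := by
    intro i _
    rw [Finset.sum_comm]
    refine Finset.sum_congr rfl fun j _ => ?_
    rw [PowerSeries.coeff_mul, Finset.smul_sum]
  rw [Finset.sum_congr rfl h2, ← sum_range_antidiagonal_eq
    (fun x => ((x.1.factorial : K)⁻¹ * (x.2.factorial : K)⁻¹) •
      coeff n (f ^ x.1 * g ^ x.2)) (n + 1)]
  · refine Finset.sum_congr rfl fun k _ => ?_
    rw [hfg.add_pow', map_sum, Finset.smul_sum]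
    refine Finset.sum_congr rfl fun x hx => ?_
    obtain rfl := Finset.HasAntidiagonal.mem_antidiagonal.1 hx
    rw [coeff_exp', map_nsmul, ← Nat.cast_smul_eq_nsmul K, smul_smul]
    congr 1
    rw [Nat.choose_symm_add, Nat.add_choose, Nat.cast_div
      (Nat.factorial_mul_factorial_dvd_factorial_add _ _)
      (Nat.cast_ne_zero.2 (by positivity))]
    have := Nat.factorial_ne_zero (x.1 + x.2)
    push_cast
    field_simp
  · intro i j hij
    have : coeff n (f ^ i * g ^ j) = 0 := by
      refine coeff_of_lt_order _ (lt_of_lt_of_le ?_ (le_order_mul _ _))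
      refine lt_of_lt_of_le ?_ (add_le_add (le_order_pow_of_constantCoeff_eq_zero i hf)
        (le_order_pow_of_constantCoeff_eq_zero j hg))
      exact_mod_cast (by omega : n < i + j)
    simp only [this, smul_zero]

/-- Exponentiate: the logarithms of commuting series commute, so `expOf_add` applies, and `log`
undoes `exp`. -/
theorem logOneAdd_mul {u v : PowerSeries C} (hu : constantCoeff u = 0) (hv : constantCoeff v = 0)
    (huv : Commute u v) :
    logOneAdd K ((1 + u) * (1 + v) - 1) = logOneAdd K u + logOneAdd K v := by
  have hc : Commute (logOneAdd K u) (logOneAdd K v) :=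
    ((huv.ncSubst_right hv _).symm.ncSubst_right hu _).symm
  have h1 := expOf_add K (constantCoeff_logOneAdd K u) (constantCoeff_logOneAdd K v) hc
  rw [expOf_logOneAdd K hu, expOf_logOneAdd K hv] at h1
  rw [← h1, logOneAdd_expOf K]
  simp [constantCoeff_logOneAdd]

theorem formalExp_eq_expOf (x : C) : formalExp K x = expOf K (PowerSeries.X * PowerSeries.C x) := by
  have h : ∀ k, (PowerSeries.X * PowerSeries.C x) ^ k =
      PowerSeries.X ^ k * PowerSeries.C (x ^ k) := by
    intro k
    rw [(PowerSeries.commute_X (PowerSeries.C x)).symm.mul_pow, map_pow]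
  ext n
  rw [formalExp, coeff_mk, expOf, coeff_ncSubst _ (by simp) (Nat.lt_succ_self n),
    Finset.sum_eq_single_of_mem n (by simp)]
  · rw [coeff_exp', h, PowerSeries.coeff_X_pow_mul']; simp
  · intro k _ hk
    rw [h, PowerSeries.coeff_X_pow_mul']
    split_ifs with hkn
    · rw [PowerSeries.coeff_C, if_neg (by omega), smul_zero]
    · rw [smul_zero]

theorem formalExp_add {x y : C} (h : Commute x y) :
    formalExp K (x + y) = formalExp K x * formalExp K y := by
  rw [formalExp_eq_expOf, formalExp_eq_expOf, formalExp_eq_expOf, map_add, mul_add]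
  refine expOf_add K (by simp) (by simp) ?_
  have hx := fun z : C => PowerSeries.commute_X (PowerSeries.C z)
  have hxy : Commute (PowerSeries.C x) (PowerSeries.C y) := h.map (PowerSeries.C : C →+* _)
  exact Commute.mul_left (Commute.mul_right (Commute.refl _) (hx y).symm)
    (Commute.mul_right (hx x) hxy)

theorem formalExp_zero : formalExp K (0 : C) = 1 := by
  rw [formalExp_eq_expOf]
  simp only [map_zero, mul_zero]
  ext n
  rw [expOf, ncSubst, coeff_mk, Finset.sum_range_succ']
  simp

theorem commute_formalExp {x y : C} (h : Commute x y) :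
    Commute (formalExp K x) (formalExp K y) := by
  rw [Commute, SemiconjBy, ← formalExp_add K h, ← formalExp_add K h.symm, add_comm]

/-- The coefficient of `t ^ n` in `log (e ^ (t x) * e ^ (t y))`. -/
theorem bchComponent_eq (n : ℕ) :
    bchComponent K n = coeff n (logOneAdd K (formalExp K (FreeAlgebra.ι K (0 : Fin 2)) *
      formalExp K (FreeAlgebra.ι K (1 : Fin 2)) - 1)) := by
  rw [bchComponent, logOneAdd, ncSubst, coeff_mk, Finset.range_eq_Ico,
    Finset.sum_eq_sum_Ico_succ_bot (Nat.succ_pos n)]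
  rw [coeff_log', Nat.cast_zero, div_zero, zero_smul, zero_add]
  exact Finset.sum_congr rfl fun k _ => by rw [coeff_log']

end ExpLog

/-! ### The homogeneous components of the Baker-Campbell-Hausdorff series are Lie words -/

section BCH

open PowerSeries

variable (K : Type*) [Field K] {B : Type*} [Ring B] [Algebra K B]

/-- The coefficient of `t ^ n` in `log (e ^ (t x) * e ^ (t y))`. -/
noncomputable def bchAt [CharZero K] (x y : B) (n : ℕ) : B :=
  coeff n (logOneAdd K (formalExp K x * formalExp K y - 1))

theorem map_bchAt [CharZero K] {B' : Type*} [Ring B'] [Algebra K B'] (ψ : B →ₐ[K] B') (x y : B)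
    (n : ℕ) : ψ (bchAt K x y n) = bchAt K (ψ x) (ψ y) n := by
  have h := map_ncSubst ψ (PowerSeries.log K) (formalExp K x * formalExp K y - 1)
  rw [map_sub, map_mul, map_one, map_formalExp, map_formalExp] at h
  rw [bchAt, bchAt, logOneAdd, logOneAdd, ← h, PowerSeries.coeff_map]
  rfl

theorem lift_bchComponent [CharZero K] (X : Fin 2 → B) (n : ℕ) :
    FreeAlgebra.lift K X (bchComponent K n) = bchAt K (X 0) (X 1) n := by
  rw [bchComponent_eq, ← bchAt, map_bchAt]
  simp

theorem bchAt_zero_zero [CharZero K] (n : ℕ) : bchAt K (0 : B) 0 n = 0 := by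
  have h := logOneAdd_expOf K (f := (0 : PowerSeries B)) (by simp)
  have h0 : expOf K (0 : PowerSeries B) = 1 := by
    rw [← formalExp_zero K, formalExp_eq_expOf]; simp
  rw [h0] at h
  rw [bchAt, formalExp_zero, mul_one, h, map_zero]

/-- The action of the free algebra on `B` extending the adjoint action of the elements `X i`. -/
noncomputable def adLift {ι : Type*} (X : ι → B) : FreeAlgebra K ι →ₐ[K] Module.End K B :=
  FreeAlgebra.lift K fun i => LinearMap.mulLeft K (X i) - LinearMap.mulRight K (X i)

/-- Commutators with `1` vanish, so only the constant term of `u` acts on `1`. -/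
theorem adLift_apply_one {ι : Type*} (X : ι → B) (u : FreeAlgebra K ι) :
    adLift K X u 1 = FreeAlgebra.lift K (fun _ => (0 : K)) u • 1 := by
  induction u using FreeAlgebra.induction with
  | grade0 r => simp [Algebra.algebraMap_eq_smul_one]
  | grade1 i => simp [adLift]
  | mul u v hu hv => rw [map_mul, Module.End.mul_apply, hv, map_smul, hu, map_mul, smul_smul,
      mul_comm]
  | add u v hu hv => rw [map_add, LinearMap.add_apply, hu, hv, map_add, add_smul]

/-- Under the action extending the adjoint action, `H_n(x₁, x₂)` acts as a commutator. -/
theorem adLift_bchComponent [CharZero K] (X : Fin 2 → B) (n : ℕ) (z : B) :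
    adLift K X (bchComponent K n) z =
      bchAt K (X 0) (X 1) n * z - z * bchAt K (X 0) (X 1) n := by
  let L : B →ₐ[K] Module.End K B := Algebra.lmul K B
  let R : Bᵐᵒᵖ →ₐ[K] Module.End K B := Algebra.lsmul K K B
  let P : Fin 2 → Module.End K B := fun i => LinearMap.mulLeft K (X i)
  let Q : Fin 2 → Module.End K B := fun i => LinearMap.mulRight K (X i)
  have hPQ : ∀ i j, Commute (P i) (Q j) := fun i j => by
    ext z; simp [P, Q, mul_assoc]
  have hsum : ∀ i, formalExp K (P i - Q i) * formalExp K (Q i) = formalExp K (P i) := fun i => by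
    rw [← formalExp_add K ((hPQ i i).sub_left (Commute.refl _)), sub_add_cancel]
  have hsum' : ∀ i, formalExp K (Q i) * formalExp K (P i - Q i) = formalExp K (P i) := fun i => by
    rw [← formalExp_add K ((hPQ i i).sub_left (Commute.refl _)).symm, add_sub_cancel]
  -- `U` is the product of the exponentials of the adjoint actions, `V` is right multiplication and
  -- `W` left multiplication by `e ^ (t x₁) * e ^ (t x₂)`. The factors of `V` appear in reverse
  -- order because right multiplication reverses products.
  set U := formalExp K (P 0 - Q 0) * formalExp K (P 1 - Q 1) with hU
  set V := formalExp K (Q 1) * formalExp K (Q 0) with hV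
  set W := formalExp K (P 0) * formalExp K (P 1) with hW
  have hUV : U * V = W := by
    rw [hU, hV, hW, mul_assoc, ← mul_assoc _ (formalExp K (Q 1)), hsum,
      (commute_formalExp K (hPQ 1 0)).eq, ← mul_assoc, hsum]
  have hVU : V * U = W := by
    rw [hU, hV, hW, mul_assoc, ← mul_assoc (formalExp K (Q 0)), hsum',
      ← mul_assoc, (commute_formalExp K (hPQ 0 1)).symm.eq, mul_assoc, hsum']
  have hlog : logOneAdd K (W - 1) = logOneAdd K (U - 1) + logOneAdd K (V - 1) := by
    rw [← logOneAdd_mul K (by simp [hU, constantCoeff_formalExp])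
      (by simp [hV, constantCoeff_formalExp])]
    · rw [add_sub_cancel, add_sub_cancel, hUV]
    -- Both products `U * V` and `V * U` equal `W`, which is what allows the logarithm to be split.
    · have : Commute U V := by rw [Commute, SemiconjBy, hUV, hVU]
      exact (this.sub_left (Commute.one_left _)).sub_right (Commute.one_right _)
  have h1 : adLift K X (bchComponent K n) = coeff n (logOneAdd K (U - 1)) := by
    rw [adLift, lift_bchComponent, bchAt]
  have h2 : L (bchAt K (X 0) (X 1) n) = coeff n (logOneAdd K (W - 1)) := map_bchAt K L _ _ n
  have h3 : R (bchAt K (MulOpposite.op (X 1)) (MulOpposite.op (X 0)) n) =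
      coeff n (logOneAdd K (V - 1)) := by
    rw [map_bchAt K R _ _ n]; rfl
  set y := bchAt K (MulOpposite.op (X 1)) (MulOpposite.op (X 0)) n with hy
  have h4 : ∀ z, adLift K X (bchComponent K n) z =
      bchAt K (X 0) (X 1) n * z - z * MulOpposite.unop y := by
    intro z
    have h5 : adLift K X (bchComponent K n) = L (bchAt K (X 0) (X 1) n) - R y := by
      rw [h1, h2, h3, hlog, map_add, add_sub_cancel_right]
    rw [h5]
    rfl
  -- Evaluation at `1` identifies `y`: the left side is the constant term of `H_n`, namely `H_n(0,
  -- 0) = 0`.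
  have h6 := h4 1
  rw [adLift_apply_one, lift_bchComponent, bchAt_zero_zero, zero_smul, mul_one, one_mul, eq_comm,
    sub_eq_zero] at h6
  rw [h4, ← h6]

end BCH

/-! ### Right-normed brackets: the Dynkin map on the free algebra. -/

section Dynkin

variable (K : Type*) [Field K] {ι : Type*} {L : Type*} [LieRing L] [LieAlgebra K L]

/-- The map `(v, c) ↦ ([x, v] + c x, 0)`. -/
noncomputable def dynkinStep (x : L) : Module.End K (L × K) :=
  LinearMap.inl K L K ∘ₗ
    ((LieAlgebra.ad K L x : Module.End K L) ∘ₗ LinearMap.fst K L K +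
      LinearMap.toSpanSingleton K L x ∘ₗ LinearMap.snd K L K)

theorem dynkinStep_apply (x : L) (w : L × K) : dynkinStep K x w = (⁅x, w.1⁆ + w.2 • x, 0) := by
  simp [dynkinStep]

/-- The action of the free algebra on `L × K` given by `dynkinStep`. -/
noncomputable def dynkinAct (ℓ : ι → L) : FreeAlgebra K ι →ₐ[K] Module.End K (L × K) :=
  FreeAlgebra.lift K fun i => dynkinStep K (ℓ i)

/-- The Dynkin map `x_{i_1} ⋯ x_{i_n} ↦ [ℓ_{i_1}, [⋯, [ℓ_{i_{n-1}}, ℓ_{i_n}]]]`. -/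
noncomputable def dynkin (ℓ : ι → L) : FreeAlgebra K ι →ₗ[K] L :=
  LinearMap.fst K L K ∘ₗ LinearMap.applyₗ (0, 1) ∘ₗ (dynkinAct K ℓ).toLinearMap

theorem dynkin_apply (ℓ : ι → L) (u : FreeAlgebra K ι) :
    dynkin K ℓ u = (dynkinAct K ℓ u (0, 1)).1 := rfl

/-- The scalar coordinate marks the empty word: from `(0, 1)` the last letter of a word produces
itself, and every earlier letter acts by bracket since the scalar is then `0`. -/
theorem map_dynkinAct {L' : Type*} [LieRing L'] [LieAlgebra K L'] (ψ : L →ₗ⁅K⁆ L') (ℓ : ι → L)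
    (u : FreeAlgebra K ι) (w : L × K) :
    dynkinAct K (fun i => ψ (ℓ i)) u (ψ w.1, w.2) =
      (ψ (dynkinAct K ℓ u w).1, (dynkinAct K ℓ u w).2) := by
  induction u using FreeAlgebra.induction generalizing w with
  | grade0 r => simp [Algebra.algebraMap_eq_smul_one]
  | grade1 i => simp [dynkinAct, dynkinStep_apply]
  | mul u v hu hv => simp only [map_mul, Module.End.mul_apply, hv, hu]
  | add u v hu hv => simp [hu, hv]

theorem map_dynkin {L' : Type*} [LieRing L'] [LieAlgebra K L'] (ψ : L →ₗ⁅K⁆ L') (ℓ : ι → L)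
    (u : FreeAlgebra K ι) : ψ (dynkin K ℓ u) = dynkin K (fun i => ψ (ℓ i)) u := by
  have h := map_dynkinAct K ψ ℓ u (0, 1)
  rw [dynkin_apply, dynkin_apply, ← map_zero ψ, h]

end Dynkin

/-! ### The degree derivation and Dynkin's identity for `H_n`. -/

section Degree

variable (K : Type*) [Field K] {ι : Type*}

/-- The algebra homomorphism `u ↦ u + ε d(u)`, where `d` is the derivation of the free algebra that
fixes the generators. -/
noncomputable def degreeHom :
    FreeAlgebra K ι →ₐ[K] TrivSqZeroExt (FreeAlgebra K ι) (FreeAlgebra K ι) :=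
  FreeAlgebra.lift K fun i => TrivSqZeroExt.inl (FreeAlgebra.ι K i) +
    TrivSqZeroExt.inr (FreeAlgebra.ι K i)

/-- The derivation of the free algebra that fixes the generators. -/
noncomputable def degreeDerivation : Module.End K (FreeAlgebra K ι) where
  toFun u := (degreeHom K u).snd
  map_add' u v := by simp
  map_smul' c u := by simp

theorem degreeDerivation_one : degreeDerivation K (1 : FreeAlgebra K ι) = 0 := by
  change (degreeHom K (1 : FreeAlgebra K ι)).snd = 0
  rw [map_one, TrivSqZeroExt.snd_one]

theorem degreeDerivation_ι_mul (i : ι) (u : FreeAlgebra K ι) :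
    degreeDerivation K (FreeAlgebra.ι K i * u) =
      FreeAlgebra.ι K i * degreeDerivation K u + FreeAlgebra.ι K i * u := by
  have hfst : ∀ u : FreeAlgebra K ι, (degreeHom K u).fst = u := by
    intro u
    have : (TrivSqZeroExt.fstHom K _ _).comp (degreeHom K) = AlgHom.id K (FreeAlgebra K ι) := by
      ext i; simp [degreeHom]
    exact DFunLike.congr_fun this u
  have hd : ∀ u : FreeAlgebra K ι, degreeDerivation K u = (degreeHom K u).snd := fun u => rfl
  rw [hd, hd, map_mul, TrivSqZeroExt.snd_mul, hfst, hfst]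
  simp [degreeHom]

/-- The product in the free algebra of the generators in a list. -/
noncomputable def freeWord (l : List ι) : FreeAlgebra K ι := (l.map (FreeAlgebra.ι K)).prod

theorem degreeDerivation_freeWord (l : List ι) :
    degreeDerivation K (freeWord K l) = (l.length : K) • freeWord K l := by
  induction l with
  | nil => simp [freeWord, degreeDerivation_one]
  | cons i l ih =>
    have : freeWord K (i :: l) = FreeAlgebra.ι K i * freeWord K l := by simp [freeWord]
    rw [this, degreeDerivation_ι_mul, ih, mul_smul_comm, List.length_cons, Nat.cast_succ, add_smul,
      one_smul]

/-- The Dynkin map and the degree derivation agree on `H_n(x₁, x₂)`. -/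
theorem dynkin_bchComponent [CharZero K] (n : ℕ) :
    dynkin K (FreeAlgebra.ι K (X := Fin 2)) (bchComponent K n) =
      degreeDerivation K (bchComponent K n) := by
  let A := FreeAlgebra K (Fin 2)
  -- The sign is chosen so that `[X i, z] = X i`. Bracketing `z` successively with letters then
  -- starts by reproducing the last letter, exactly as the Dynkin map does.
  let z : Module.End K A := -degreeDerivation K
  let X : Fin 2 → Module.End K A := fun i => Algebra.lmul K A (FreeAlgebra.ι K i)
  have hXz : ∀ i, X i * z - z * X i = X i := by
    intro i
    ext u
    change FreeAlgebra.ι K i * -degreeDerivation K u - -degreeDerivation K (FreeAlgebra.ι K i * u) =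
      FreeAlgebra.ι K i * u
    rw [degreeDerivation_ι_mul, mul_neg]
    abel
  have key : ∀ (u : A) (w : A × K),
      Algebra.lmul K A (dynkinAct K (FreeAlgebra.ι K) u w).1 +
        (dynkinAct K (FreeAlgebra.ι K) u w).2 • z =
      adLift K X u (Algebra.lmul K A w.1 + w.2 • z) := by
    intro u
    induction u using FreeAlgebra.induction with
    | grade0 r => intro w; simp [Algebra.algebraMap_eq_smul_one, smul_smul]
    | grade1 i =>
      intro w
      have h1 : dynkinAct K (FreeAlgebra.ι K) (FreeAlgebra.ι K i) w =
          (⁅FreeAlgebra.ι K i, w.1⁆ + w.2 • FreeAlgebra.ι K i, 0) := by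
        rw [dynkinAct, FreeAlgebra.lift_ι_apply, dynkinStep_apply]
      have h2 : adLift K X (FreeAlgebra.ι K i) (Algebra.lmul K A w.1 + w.2 • z) =
          X i * Algebra.lmul K A w.1 - Algebra.lmul K A w.1 * X i +
            w.2 • (X i * z - z * X i) := by
        simp only [adLift, FreeAlgebra.lift_ι_apply, LinearMap.sub_apply,
          LinearMap.mulLeft_apply, LinearMap.mulRight_apply, mul_add, add_mul, mul_smul_comm,
          smul_mul_assoc, smul_sub]
        abel
      rw [h1, h2, hXz, zero_smul, add_zero, map_add, map_smul, LieRing.of_associative_ring_bracket,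
        map_sub, map_mul, map_mul]
    | mul u v hu hv => intro w; rw [map_mul, map_mul, Module.End.mul_apply, Module.End.mul_apply,
        hu, hv]
    | add u v hu hv =>
      intro w
      rw [map_add (adLift K X) u v, map_add (dynkinAct K (FreeAlgebra.ι K)) u v,
        LinearMap.add_apply, LinearMap.add_apply (adLift K X u), ← hu, ← hv,
        Prod.fst_add, Prod.snd_add, map_add, add_smul]
      abel
  have h1 := key (bchComponent K n) (0, 1)
  rw [adLift_bchComponent, map_zero, zero_add, one_smul, ← map_bchAt K (Algebra.lmul K A)] at h1
  have h2 : bchAt K (FreeAlgebra.ι K (0 : Fin 2)) (FreeAlgebra.ι K 1) n = bchComponent K n := by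
    rw [bchComponent_eq, bchAt]
  rw [h2] at h1
  -- The operator identity now reads: left multiplication by the Dynkin image is `[H_n, z]`. At `1`
  -- the derivation vanishes, and only the derivative of `H_n` remains.
  have h3 := LinearMap.congr_fun h1 1
  have h4 : degreeDerivation K (1 : A) = 0 := degreeDerivation_one K
  simpa [z, h4, ← dynkin_apply] using h3

end Degree

/-! ### Denominators -/

section Denominators

/-- `p ^ s q` is a `p`-adic integer for some `s` with `s (p - 1) ≤ i`. -/
def HasDenom (p : ℕ) [Fact p.Prime] (q : ℚ_[p]) (i : ℕ) : Prop :=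
  ∃ s, s * (p - 1) ≤ i ∧ ∃ r : ℤ_[p], (p : ℚ_[p]) ^ s * q = r

variable {p : ℕ} [hp : Fact p.Prime]

theorem exists_pow_mul_inv_natCast {N : ℕ} (hN : N ≠ 0) :
    ∃ r : ℤ_[p], (p : ℚ_[p]) ^ (padicValNat p N) * (N : ℚ_[p])⁻¹ = r := by
  refine ⟨⟨(p : ℚ_[p]) ^ (padicValNat p N) * (N : ℚ_[p])⁻¹, ?_⟩, rfl⟩
  have hp0 : (p : ℚ_[p]) ≠ 0 := Nat.cast_ne_zero.2 hp.out.ne_zero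
  obtain ⟨m, hm⟩ := pow_padicValNat_dvd (p := p) (n := N)
  have hm' : ¬ p ∣ m := by
    rintro ⟨c, rfl⟩
    refine pow_succ_padicValNat_not_dvd hN (p := p) ⟨c, ?_⟩
    rw [pow_succ, mul_assoc, ← hm]
  have hnorm : ‖(m : ℚ_[p])‖ = 1 :=
    Padic.norm_natCast_eq_one_iff.2 ((Nat.Prime.coprime_iff_not_dvd hp.out).2 hm')
  have hcast : (N : ℚ_[p]) = (p : ℚ_[p]) ^ (padicValNat p N) * m := by
    conv_lhs => rw [hm]
    push_cast
    rfl
  generalize padicValNat p N = e at hcast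
  rw [hcast, mul_inv, ← mul_assoc, mul_inv_cancel₀ (pow_ne_zero _ hp0), one_mul, norm_inv, hnorm,
    inv_one]

/-- Bernoulli's inequality: `1 + r (p - 1) ≤ p ^ r ≤ n` for the valuation `r` of `n`. -/
theorem padicValNat_mul_le {n : ℕ} (hn : n ≠ 0) : padicValNat p n * (p - 1) ≤ n - 1 := by
  have h1 : p ^ padicValNat p n ≤ n := Nat.le_of_dvd (Nat.pos_of_ne_zero hn) pow_padicValNat_dvd
  have h2 : ∀ r, 1 + r * (p - 1) ≤ p ^ r := by
    intro r
    obtain ⟨q, hq⟩ : ∃ q, p = q + 1 := ⟨p - 1, by have := hp.out.one_lt; omega⟩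
    induction r with
    | zero => simp
    | succ r ih =>
      rw [hq] at ih ⊢
      rw [pow_succ]
      simp only [Nat.add_sub_cancel] at ih ⊢
      have h3 : 1 ≤ (q + 1) ^ r := Nat.one_le_pow _ _ (Nat.succ_pos q)
      have h4 := Nat.mul_le_mul_right q h3
      rw [mul_add, add_mul]
      omega
  have := h2 (padicValNat p n)
  omega

/-- Legendre's formula: `(p - 1) v_p(n!)` is `n` minus the digit sum of `n` in base `p`, and that
sum is at least `1`. -/
theorem padicValNat_factorial_mul_le {n : ℕ} (hn : n ≠ 0) :
    padicValNat p n.factorial * (p - 1) ≤ n - 1 := by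
  rw [mul_comm, sub_one_mul_padicValNat_factorial]
  have : 0 < (p.digits n).sum := by
    refine List.sum_pos_iff_exists_pos_nat.2
      ⟨(p.digits n).getLast (Nat.digits_ne_nil_iff_ne_zero.2 hn), List.getLast_mem _, ?_⟩
    exact Nat.pos_of_ne_zero (Nat.getLast_digit_ne_zero p hn)
  omega

theorem hasDenom_coeff_log {k : ℕ} (hk : 1 ≤ k) :
    HasDenom p (PowerSeries.coeff k (PowerSeries.log ℚ_[p])) (k - 1) := by
  obtain ⟨r, hr⟩ := exists_pow_mul_inv_natCast (p := p) (show k ≠ 0 by omega)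
  refine ⟨_, padicValNat_mul_le (by omega), (-1) ^ (k + 1) * r, ?_⟩
  rw [coeff_log', div_eq_mul_inv, mul_left_comm, hr]
  push_cast
  rfl

theorem hasDenom_inv_factorial {k : ℕ} (hk : 1 ≤ k) :
    HasDenom p (k.factorial : ℚ_[p])⁻¹ (k - 1) :=
  ⟨_, padicValNat_factorial_mul_le (by omega), exists_pow_mul_inv_natCast k.factorial_ne_zero⟩

theorem hasDenom_coeff_expSubOne {k : ℕ} (hk : 1 ≤ k) :
    HasDenom p (PowerSeries.coeff k (expSubOne ℚ_[p])) (k - 1) := by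
  rw [expSubOne, map_sub, coeff_exp', PowerSeries.coeff_one, if_neg (by omega), sub_zero]
  exact hasDenom_inv_factorial hk

variable {A : Type*} [Ring A] [Algebra ℤ_[p] A]

/-- The elements `x` such that `p ^ s x` lies in the `n`-th lattice for some `s` with
`s (p - 1) ≤ j`. -/
def denomSubmodule (Λ : ℕ → Submodule ℤ_[p] A) (n j : ℕ) : Submodule ℤ_[p] A where
  carrier := {x | ∃ s, s * (p - 1) ≤ j ∧ (p : ℤ_[p]) ^ s • x ∈ Λ n}
  zero_mem' := ⟨0, by simp, by simp⟩
  add_mem' := by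
    rintro x y ⟨s, hs, hx⟩ ⟨t, ht, hy⟩
    rcases le_total s t with h | h
    · refine ⟨t, ht, ?_⟩
      rw [smul_add]
      refine add_mem ?_ hy
      rw [← Nat.sub_add_cancel h, pow_add, mul_smul]
      exact Submodule.smul_mem _ _ hx
    · refine ⟨s, hs, ?_⟩
      rw [smul_add]
      refine add_mem hx ?_
      rw [← Nat.sub_add_cancel h, pow_add, mul_smul]
      exact Submodule.smul_mem _ _ hy
  smul_mem' := by
    rintro c x ⟨s, hs, hx⟩
    exact ⟨s, hs, by rw [smul_comm]; exact Submodule.smul_mem _ _ hx⟩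

variable {Λ : ℕ → Submodule ℤ_[p] A}

theorem denomSubmodule_mono {n i j : ℕ} (h : i ≤ j) :
    denomSubmodule Λ n i ≤ denomSubmodule Λ n j := by
  rintro x ⟨s, hs, hx⟩
  exact ⟨s, hs.trans h, hx⟩

theorem mem_denomSubmodule_of_mem {n : ℕ} (j : ℕ) {x : A} (hx : x ∈ Λ n) :
    x ∈ denomSubmodule Λ n j := ⟨0, by simp, by simpa using hx⟩

theorem mul_mem_denomSubmodule (hΛ : ∀ m n x y, x ∈ Λ m → y ∈ Λ n → x * y ∈ Λ (m + n))
    {m n i j : ℕ} {x y : A} (hx : x ∈ denomSubmodule Λ m i) (hy : y ∈ denomSubmodule Λ n j) :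
    x * y ∈ denomSubmodule Λ (m + n) (i + j) := by
  obtain ⟨s, hs, hx⟩ := hx
  obtain ⟨t, ht, hy⟩ := hy
  refine ⟨s + t, by rw [add_mul]; omega, ?_⟩
  rw [pow_add, ← smul_mul_smul_comm]
  exact hΛ _ _ _ _ hx hy

open PowerSeries

/-- A power series without constant term whose coefficients of degree `n ≥ 1` have denominators
of valuation at most `(n - 1) / (p - 1)` with respect to the lattices `Λ n`. -/
structure HasSmallDenoms (Λ : ℕ → Submodule ℤ_[p] A) (f : PowerSeries A) : Prop where
  constantCoeff_eq : constantCoeff f = 0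
  coeff_mem : ∀ n, 1 ≤ n → coeff n f ∈ denomSubmodule Λ n (n - 1)

theorem HasSmallDenoms.add {f g : PowerSeries A} (hf : HasSmallDenoms Λ f)
    (hg : HasSmallDenoms Λ g) : HasSmallDenoms Λ (f + g) :=
  ⟨by simp [hf.1, hg.1], fun n hn => by rw [map_add]; exact add_mem (hf.2 n hn) (hg.2 n hn)⟩

/-- Every factor of `f ^ k` saves one unit, so the allowance drops to `n - k`. This leaves room for
the `k - 1` taken by the coefficient of `exp` or `log` in degree `k`, and the class is stable under
composition. -/
theorem HasSmallDenoms.pow_coeff_mem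
    (hΛ : ∀ m n x y, x ∈ Λ m → y ∈ Λ n → x * y ∈ Λ (m + n))
    {f : PowerSeries A} (hf : HasSmallDenoms Λ f) (k n : ℕ) (hkn : k + 1 ≤ n) :
    coeff n (f ^ (k + 1)) ∈ denomSubmodule Λ n (n - (k + 1)) := by
  induction k generalizing n with
  | zero => simpa using hf.2 n hkn
  | succ k ih =>
    rw [pow_succ, PowerSeries.coeff_mul]
    refine sum_mem fun x hx => ?_
    rw [Finset.HasAntidiagonal.mem_antidiagonal] at hx
    rcases lt_or_ge x.1 (k + 1) with h1 | h1
    · rw [coeff_pow_eq_zero_of_lt hf.1 h1, zero_mul]; exact zero_mem _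
    rcases Nat.eq_zero_or_pos x.2 with h2 | h2
    · rw [h2, coeff_zero_eq_constantCoeff_apply, hf.1, mul_zero]; exact zero_mem _
    · have := mul_mem_denomSubmodule hΛ (ih x.1 h1) (hf.2 x.2 h2)
      rw [hx] at this
      exact denomSubmodule_mono (by omega) this

theorem HasSmallDenoms.mul (hΛ : ∀ m n x y, x ∈ Λ m → y ∈ Λ n → x * y ∈ Λ (m + n))
    {f g : PowerSeries A} (hf : HasSmallDenoms Λ f) (hg : HasSmallDenoms Λ g) :
    HasSmallDenoms Λ (f * g) := by
  refine ⟨by simp [hf.1], fun n _ => ?_⟩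
  rw [PowerSeries.coeff_mul]
  refine sum_mem fun x hx => ?_
  rw [Finset.HasAntidiagonal.mem_antidiagonal] at hx
  rcases Nat.eq_zero_or_pos x.1 with h1 | h1
  · rw [h1, coeff_zero_eq_constantCoeff_apply, hf.1, zero_mul]; exact zero_mem _
  rcases Nat.eq_zero_or_pos x.2 with h2 | h2
  · rw [h2, coeff_zero_eq_constantCoeff_apply, hg.1, mul_zero]; exact zero_mem _
  · have := mul_mem_denomSubmodule hΛ (hf.2 x.1 h1) (hg.2 x.2 h2)
    rw [hx] at this
    exact denomSubmodule_mono (by omega) this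

theorem hasSmallDenoms_X_mul_C {x : A} (hx : x ∈ Λ 1) :
    HasSmallDenoms Λ (PowerSeries.X * PowerSeries.C x) := by
  refine ⟨by simp, fun n hn => ?_⟩
  obtain ⟨n, rfl⟩ : ∃ m, n = m + 1 := ⟨n - 1, by omega⟩
  rw [PowerSeries.coeff_succ_X_mul, PowerSeries.coeff_C]
  split_ifs with h
  · subst h; exact mem_denomSubmodule_of_mem _ hx
  · exact zero_mem _

variable [Algebra ℚ_[p] A] [IsScalarTower ℤ_[p] ℚ_[p] A]

theorem smul_mem_denomSubmodule {q : ℚ_[p]} {i j n : ℕ} (hq : HasDenom p q i) {x : A}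
    (hx : x ∈ denomSubmodule Λ n j) : q • x ∈ denomSubmodule Λ n (i + j) := by
  obtain ⟨s, hs, r, hr⟩ := hq
  obtain ⟨t, ht, hx⟩ := hx
  refine ⟨s + t, by rw [add_mul]; omega, ?_⟩
  have : (p : ℤ_[p]) ^ (s + t) • q • x = r • (p : ℤ_[p]) ^ t • x := by
    rw [pow_add, mul_smul, smul_comm _ q x, ← algebraMap_smul ℚ_[p] (_ ^ s) (q • _), smul_smul,
      map_pow, map_natCast, hr, ← algebraMap_smul ℚ_[p] r]
    rfl
  rw [this]
  exact Submodule.smul_mem _ _ hx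

theorem HasSmallDenoms.smul_coeff_mem
    (hΛ : ∀ m n x y, x ∈ Λ m → y ∈ Λ n → x * y ∈ Λ (m + n))
    {f : PowerSeries A} (hf : HasSmallDenoms Λ f) {q : ℚ_[p]} {k n : ℕ} (hk : 1 ≤ k)
    (hn : 1 ≤ n) (hq : HasDenom p q (k - 1)) :
    q • coeff n (f ^ k) ∈ denomSubmodule Λ n (n - 1) := by
  rcases lt_or_ge n k with h | h
  · rw [coeff_pow_eq_zero_of_lt hf.1 h, smul_zero]; exact zero_mem _
  · obtain ⟨k, rfl⟩ : ∃ j, k = j + 1 := ⟨k - 1, by omega⟩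
    exact denomSubmodule_mono (by omega)
      (smul_mem_denomSubmodule hq (hf.pow_coeff_mem hΛ k n h))

theorem HasSmallDenoms.ncSubst (hΛ : ∀ m n x y, x ∈ Λ m → y ∈ Λ n → x * y ∈ Λ (m + n))
    {f : PowerSeries A} (hf : HasSmallDenoms Λ f) {g : PowerSeries ℚ_[p]}
    (hg0 : constantCoeff g = 0) (hg : ∀ k, 1 ≤ k → HasDenom p (coeff k g) (k - 1)) :
    HasSmallDenoms Λ (ncSubst g f) := by
  refine ⟨by rw [constantCoeff_ncSubst, hg0, zero_smul], fun n hn => ?_⟩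
  rw [_root_.ncSubst, coeff_mk]
  refine sum_mem fun k _ => ?_
  rcases Nat.eq_zero_or_pos k with rfl | hk
  · rw [coeff_zero_eq_constantCoeff_apply, hg0, zero_smul]; exact zero_mem _
  · exact hf.smul_coeff_mem hΛ hk hn (hg k hk)

theorem HasSmallDenoms.logOneAdd (hΛ : ∀ m n x y, x ∈ Λ m → y ∈ Λ n → x * y ∈ Λ (m + n))
    {f : PowerSeries A} (hf : HasSmallDenoms Λ f) : HasSmallDenoms Λ (logOneAdd ℚ_[p] f) :=
  hf.ncSubst hΛ (by simp) fun _ hk => hasDenom_coeff_log hk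

theorem hasSmallDenoms_formalExp_sub_one
    (hΛ : ∀ m n x y, x ∈ Λ m → y ∈ Λ n → x * y ∈ Λ (m + n)) {x : A} (hx : x ∈ Λ 1) :
    HasSmallDenoms Λ (formalExp ℚ_[p] x - 1) := by
  rw [formalExp_eq_expOf, expOf_eq, add_sub_cancel_left]
  exact (hasSmallDenoms_X_mul_C hx).ncSubst hΛ (constantCoeff_expSubOne _)
    fun _ hk => hasDenom_coeff_expSubOne hk

theorem hasSmallDenoms_formalExp_mul_sub_one
    (hΛ : ∀ m n x y, x ∈ Λ m → y ∈ Λ n → x * y ∈ Λ (m + n)) {x y : A} (hx : x ∈ Λ 1)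
    (hy : y ∈ Λ 1) : HasSmallDenoms Λ (formalExp ℚ_[p] x * formalExp ℚ_[p] y - 1) := by
  have h1 := hasSmallDenoms_formalExp_sub_one hΛ hx
  have h2 := hasSmallDenoms_formalExp_sub_one hΛ hy
  have h3 := (h1.add h2).add (h1.mul hΛ h2)
  convert h3 using 1
  noncomm_ring

/-- The `ℤ_p`-lattice spanned by the words of length `n` in the free algebra over `ℚ_p`. -/
noncomputable def wordLattice (p : ℕ) [Fact p.Prime] (ι : Type*) (n : ℕ) :
    Submodule ℤ_[p] (FreeAlgebra ℚ_[p] ι) :=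
  Submodule.span ℤ_[p] {w | ∃ l : List ι, l.length = n ∧ freeWord ℚ_[p] l = w}

theorem mul_mem_wordLattice {ι : Type*} (m n : ℕ) (x y : FreeAlgebra ℚ_[p] ι)
    (hx : x ∈ wordLattice p ι m) (hy : y ∈ wordLattice p ι n) :
    x * y ∈ wordLattice p ι (m + n) := by
  have h := Submodule.mul_mem_mul hx hy
  rw [wordLattice, wordLattice, Submodule.span_mul_span] at h
  refine Submodule.span_mono ?_ h
  rintro _ ⟨_, ⟨l, hl, rfl⟩, _, ⟨l', hl', rfl⟩, rfl⟩
  exact ⟨l ++ l', by simp [hl, hl'], by simp [freeWord]⟩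

/-- The general estimates, applied to the lattices of words in the free algebra, give both the
homogeneity of `H_n` and a bound on its denominators. -/
theorem bchComponent_mem_denomSubmodule {n : ℕ} (hn : 1 ≤ n) :
    bchComponent ℚ_[p] n ∈ denomSubmodule (wordLattice p (Fin 2)) n (n - 1) := by
  have hι : ∀ i : Fin 2, FreeAlgebra.ι ℚ_[p] i ∈ wordLattice p (Fin 2) 1 := fun i =>
    Submodule.subset_span ⟨[i], rfl, by simp [freeWord]⟩
  rw [bchComponent_eq]
  exact ((hasSmallDenoms_formalExp_mul_sub_one mul_mem_wordLattice (hι 0) (hι 1)).logOneAdd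
    mul_mem_wordLattice).coeff_mem n hn

theorem degreeDerivation_of_mem_wordLattice {n : ℕ} {ι : Type*} {u : FreeAlgebra ℚ_[p] ι}
    (hu : u ∈ wordLattice p ι n) : degreeDerivation ℚ_[p] u = (n : ℚ_[p]) • u := by
  induction hu using Submodule.span_induction with
  | mem x hx =>
    obtain ⟨l, rfl, rfl⟩ := hx
    exact degreeDerivation_freeWord _ l
  | zero => simp
  | add x y _ _ hx hy => rw [map_add, hx, hy, smul_add]
  | smul c x _ hx =>
    rw [← algebraMap_smul ℚ_[p] c x, map_smul, hx, smul_comm]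

theorem degreeDerivation_bchComponent {n : ℕ} (hn : 1 ≤ n) :
    degreeDerivation ℚ_[p] (bchComponent ℚ_[p] n) = (n : ℚ_[p]) • bchComponent ℚ_[p] n := by
  obtain ⟨s, -, hs⟩ := bchComponent_mem_denomSubmodule (p := p) hn
  have h := degreeDerivation_of_mem_wordLattice hs
  rw [← algebraMap_smul ℚ_[p], map_smul, smul_comm (n : ℚ_[p])] at h
  have hp0 : algebraMap ℤ_[p] ℚ_[p] ((p : ℤ_[p]) ^ s) ≠ 0 := by
    rw [map_pow, map_natCast]
    exact pow_ne_zero _ (Nat.cast_ne_zero.2 hp.out.ne_zero)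
  exact smul_right_injective _ hp0 h

/-- `H_n(x₁, x₂)` as a Lie word (for `n ≥ 1`). -/
noncomputable def bchLieWord (p : ℕ) [Fact p.Prime] (n : ℕ) : FreeLieAlgebra ℚ_[p] (Fin 2) :=
  (n : ℚ_[p])⁻¹ • dynkin ℚ_[p] (FreeLieAlgebra.of ℚ_[p]) (bchComponent ℚ_[p] n)

theorem bchComponent_zero (K : Type*) [Field K] : bchComponent K 0 = 0 := by
  simp [bchComponent]

theorem lieWordToAssoc_bchLieWord (n : ℕ) :
    lieWordToAssoc ℚ_[p] (bchLieWord p n) = bchComponent ℚ_[p] n := by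
  rcases Nat.eq_zero_or_pos n with rfl | hn
  · simp [bchLieWord, bchComponent_zero]
  · rw [bchLieWord, map_smul, map_dynkin]
    have : (fun i => lieWordToAssoc ℚ_[p] (FreeLieAlgebra.of ℚ_[p] i)) =
        FreeAlgebra.ι ℚ_[p] (X := Fin 2) := by
      funext i; simp [lieWordToAssoc]
    rw [this, dynkin_bchComponent, degreeDerivation_bchComponent hn, smul_smul,
      inv_mul_cancel₀ (Nat.cast_ne_zero.2 (by omega)), one_smul]

end Denominators

/-! ### Numerical bounds on the exponents of `p`. -/

section Exponents

/-- The exponent `κ` with `𝐩 = p ^ κ`. -/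
def boldExp (p : ℕ) : ℕ := if p = 2 then 2 else 1

theorem boldP_eq_pow (p : ℕ) : boldP p = p ^ boldExp p := by
  unfold boldP boldExp
  split_ifs with h <;> simp [h]

theorem four_mul_le_two_pow_add (r : ℕ) : 4 * r ≤ 2 ^ r + 4 := by
  induction r with
  | zero => simp
  | succ r ih =>
    rcases Nat.lt_or_ge r 2 with h | h
    · interval_cases r <;> simp
    · have : 2 ^ 2 ≤ 2 ^ r := Nat.pow_le_pow_right (by norm_num) h
      rw [pow_succ]
      omega

/-- Here `s` stands for the denominators of the coefficients and `r` for the valuation of `n`. The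
first bound puts `𝐩 ^ n / p ^ (s + r)` in `𝐩 ℤ_p`; the second makes its exponent at least `(n - 2) /
4`, which gives convergence. The linear bounds alone would not do: for `p = 3` they allow `s + r = n
- 1`. Growth comes from `4 r ≤ 2 ^ r + 4 ≤ n + 4`. -/
theorem exponent_bounds {p : ℕ} (hp : p.Prime) {n s r : ℕ} (hn : 1 ≤ n) (hs : s * (p - 1) ≤ n - 1)
    (hr : r * (p - 1) ≤ n - 1) (hrn : p ^ r ≤ n) :
    s + r + boldExp p ≤ boldExp p * n ∧ n + 4 * (s + r) ≤ 4 * (boldExp p * n) + 2 := by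
  have h2 : 2 ^ r ≤ p ^ r := Nat.pow_le_pow_left hp.two_le r
  have h3 := four_mul_le_two_pow_add r
  unfold boldExp
  split_ifs with h
  · subst h
    omega
  · have hp3 : 2 ≤ p - 1 := by have := hp.two_le; omega
    have h4 : s * 2 ≤ s * (p - 1) := Nat.mul_le_mul_left s hp3
    have h5 : r * 2 ≤ r * (p - 1) := Nat.mul_le_mul_left r hp3
    omega

end Exponents

/-! ### The `p`-adic topology -/

section PadicTopology

variable (p : ℕ) [hp : Fact p.Prime] (L : Type*) [AddCommGroup L] [Module ℤ_[p] L]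

/-- The submodule `p ^ m L`. -/
noncomputable def pPow (m : ℕ) : Submodule ℤ_[p] L :=
  LinearMap.range (LinearMap.lsmul ℤ_[p] L ((p : ℤ_[p]) ^ m))

variable {L}

theorem mem_pPow {m : ℕ} {x : L} : x ∈ pPow p L m ↔ ∃ y, (p : ℤ_[p]) ^ m • y = x := Iff.rfl

theorem pPow_anti {m n : ℕ} (h : m ≤ n) : pPow p L n ≤ pPow p L m := by
  rintro _ ⟨y, rfl⟩
  refine ⟨(p : ℤ_[p]) ^ (n - m) • y, ?_⟩
  simp only [LinearMap.lsmul_apply]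
  rw [smul_smul, ← pow_add, Nat.add_sub_cancel' h]

theorem span_pow_smul_top (m : ℕ) :
    (Ideal.span {(p : ℤ_[p])}) ^ m • (⊤ : Submodule ℤ_[p] L) = pPow p L m := by
  rw [Ideal.span_singleton_pow, Submodule.ideal_span_singleton_smul]
  ext x
  rw [mem_pPow, Submodule.mem_smul_pointwise_iff_exists]
  simp

theorem padic_nhds_zero_hasBasis :
    (@nhds L (padicTop p L) 0).HasBasis (fun _ : ℕ => True) fun m => (pPow p L m : Set L) := by
  let I := Ideal.span {(p : ℤ_[p])}
  refine ⟨fun t => ?_⟩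
  let := I.adic_basis.topology
  have h := (I.ringFilterBasis.moduleFilterBasis
    (I.adic_module_basis L)).toAddGroupFilterBasis.nhds_zero_hasBasis.mem_iff (t := t)
  refine h.trans ⟨?_, ?_⟩
  · rintro ⟨_, ⟨m, rfl⟩, hm⟩
    exact ⟨m, trivial, by rw [← span_pow_smul_top]; exact hm⟩
  · rintro ⟨m, -, hm⟩
    exact ⟨_, ⟨m, rfl⟩, by rw [← span_pow_smul_top] at hm; exact hm⟩

theorem padic_nonarchimedeanAddGroup : @NonarchimedeanAddGroup L _ (padicTop p L) := by
  let I := Ideal.span {(p : ℤ_[p])}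
  let := I.adic_basis.topology
  exact (I.ringFilterBasis.submodulesBasisIsBasis (I.adic_module_basis L)).nonarchimedean

theorem padic_tendsto_iff {α : Type*} {l : Filter α} {u : α → L} {x : L} :
    Tendsto u l (@nhds L (padicTop p L) x) ↔ ∀ m, ∀ᶠ i in l, u i - x ∈ pPow p L m := by
  let := padicTop p L
  have := padic_nonarchimedeanAddGroup p (L := L)
  rw [← tendsto_sub_nhds_zero_iff, (padic_nhds_zero_hasBasis p).tendsto_right_iff]
  simp

/-- The family `t` is unconditionally summable with sum `s` in the `p`-adic topology. -/
def HasPSum {α : Type*} (t : α → L) (s : L) : Prop := 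
  @HasSum L α _ (padicTop p L) t s (SummationFilter.unconditional α)

theorem hasPSum_iff {α : Type*} {t : α → L} {s : L} : HasPSum p t s ↔
    ∀ m, ∀ᶠ F : Finset α in atTop, ∑ i ∈ F, t i - s ∈ pPow p L m := by
  rw [← SummationFilter.unconditional_filter]
  exact padic_tendsto_iff p

variable {p}

theorem HasPSum.hasPadicSum {t : ℕ → L} {s : L} (h : HasPSum p t s) : HasPadicSum p t s := by
  let := padicTop p L
  exact HasSum.tendsto_sum_nat h

theorem HasPSum.comp_injective {α β : Type*} {t : β → L} {s : L} {e : α → β} (h : HasPSum p t s)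
    (he : Function.Injective e) (h0 : ∀ b, b ∉ Set.range e → t b = 0) : HasPSum p (t ∘ e) s := by
  let := padicTop p L
  exact (he.hasSum_iff h0).2 h

theorem HasPSum.mem {t : ℕ → L} {s : L} (h : HasPSum p t s) {m : ℕ}
    (ht : ∀ i, t i ∈ pPow p L m) : s ∈ pPow p L m := by
  obtain ⟨F, hF⟩ := (eventually_atTop.1 ((hasPSum_iff p).1 h m))
  have h1 : ∑ i ∈ F, t i ∈ pPow p L m := sum_mem fun i _ => ht i
  simpa using sub_mem h1 (hF F le_rfl)

theorem exists_hasPSum [hL : IsPrecomplete (Ideal.span {(p : ℤ_[p])}) L] {α : Type*} {t : α → L}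
    (ht : ∀ m, ∀ᶠ i in cofinite, t i ∈ pPow p L m) : ∃ s, HasPSum p t s := by
  -- `F m` collects the finitely many indices whose terms are outside `p ^ m L`. The sums over `F m`
  -- form a Cauchy sequence, and its limit is the sum of the family.
  let F : ℕ → Finset α := fun m => (eventually_cofinite.1 (ht m)).toFinset
  have hF : ∀ m i, i ∉ F m → t i ∈ pPow p L m := by
    intro m i hi
    by_contra h
    exact hi (by simpa [F] using h)
  have key : ∀ m (G : Finset α), F m ⊆ G → ∑ i ∈ G, t i - ∑ i ∈ F m, t i ∈ pPow p L m := by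
    classical
    intro m G hG
    rw [← Finset.sum_sdiff hG, add_sub_cancel_right]
    exact sum_mem fun i hi => hF m i (Finset.mem_sdiff.1 hi).2
  have hmono : ∀ {m n}, m ≤ n → F m ⊆ F n := by
    intro m n hmn i hi
    by_contra h
    have h1 := pPow_anti p hmn (hF n i h)
    simp only [F, Set.Finite.mem_toFinset] at hi
    exact hi h1
  obtain ⟨s, hs⟩ := hL.prec (f := fun m => ∑ i ∈ F m, t i) (by
    intro m n hmn
    rw [span_pow_smul_top]
    exact (SModEq.sub_mem.2 (key m _ (hmono hmn))).symm)
  refine ⟨s, (hasPSum_iff p).2 fun m => eventually_atTop.2 ⟨F m, fun G hG => ?_⟩⟩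
  have h1 := hs m
  rw [span_pow_smul_top, SModEq.sub_mem] at h1
  simpa using add_mem (key m G hG) h1

theorem eq_of_padicTendsto [hL : IsHausdorff (Ideal.span {(p : ℤ_[p])}) L] {u : ℕ → L} {x y : L}
    (hx : PadicTendsto p u x) (hy : PadicTendsto p u y) : x = y := by
  rw [← sub_eq_zero]
  refine hL.haus _ fun m => ?_
  rw [span_pow_smul_top, SModEq.zero]
  obtain ⟨n, h1, h2⟩ := (((padic_tendsto_iff p).1 hx m).and ((padic_tendsto_iff p).1 hy m)).exists
  simpa using sub_mem h2 h1

/-- Used together with `HasPSum.swap` to sum one double family by rows and by columns. -/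
theorem HasPSum.prod_fiberwise {α β : Type*} {t : α × β → L} {s : L} {a : α → L}
    (h : HasPSum p t s) (h' : ∀ i, HasPSum p (fun j => t (i, j)) (a i)) : HasPSum p a s := by
  let := padicTop p L
  have := padic_nonarchimedeanAddGroup p (L := L)
  exact HasSum.prod_fiberwise h h'

theorem HasPSum.swap {α β : Type*} {t : α × β → L} {s : L} (h : HasPSum p t s) :
    HasPSum p (fun x : β × α => t x.swap) s := by
  let := padicTop p L
  exact (Equiv.hasSum_iff (Equiv.prodComm β α)).2 h

theorem HasPSum.add {α : Type*} {t t' : α → L} {s s' : L}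
    (h : HasPSum p t s) (h' : HasPSum p t' s') : HasPSum p (t + t') (s + s') := by
  let := padicTop p L
  have := padic_nonarchimedeanAddGroup p (L := L)
  exact HasSum.add h h'

theorem hasPSum_single {α : Type*} {t : α → L} (i : α) (h : ∀ j, j ≠ i → t j = 0) :
    HasPSum p t (t i) := by
  let := padicTop p L
  exact hasSum_single i h

theorem PadicTendsto.mem_of_isClosed {M : Set L} (hM : @IsClosed L (padicTop p L) M) {u : ℕ → L} {x : L}
    (hx : PadicTendsto p u x) (hu : ∀ n, u n ∈ M) : x ∈ M := by
  let := padicTop p L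
  exact hM.mem_of_tendsto hx (Eventually.of_forall hu)

end PadicTopology

/-! ### Products of convergent series. -/

section PadicRing

variable {p : ℕ} [hp : Fact p.Prime] {D : Type*} [Ring D] [Algebra ℤ_[p] D]

theorem mul_mem_pPow_left {m : ℕ} (x : D) {y : D} (hy : y ∈ pPow p D m) : x * y ∈ pPow p D m := by
  obtain ⟨y, rfl⟩ := hy
  exact ⟨x * y, by simp [LinearMap.lsmul_apply]⟩

theorem mul_mem_pPow_right {m : ℕ} {x : D} (y : D) (hx : x ∈ pPow p D m) :
    x * y ∈ pPow p D m := by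
  obtain ⟨x, rfl⟩ := hx
  exact ⟨x * y, by simp [LinearMap.lsmul_apply]⟩

theorem padic_nonarchimedeanRing : @NonarchimedeanRing D _ (padicTop p D) := by
  let := padicTop p D
  have := padic_nonarchimedeanAddGroup p (L := D)
  have : IsTopologicalRing D := by
    have hb := padic_nhds_zero_hasBasis p (L := D)
    refine IsTopologicalRing.of_addGroup_of_nhds_zero ?_ ?_ ?_
    · rw [hb.tendsto_right_iff]
      intro m _
      have h1 : ∀ᶠ x : D in nhds 0, x ∈ pPow p D m := hb.mem_of_mem trivial
      exact (h1.prod_inl _).mono fun x hx => mul_mem_pPow_right _ hx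
    · intro x
      rw [hb.tendsto_right_iff]
      intro m _
      have h1 : ∀ᶠ x : D in nhds 0, x ∈ pPow p D m := hb.mem_of_mem trivial
      exact h1.mono fun y hy => mul_mem_pPow_left x hy
    · intro x
      rw [hb.tendsto_right_iff]
      intro m _
      have h1 : ∀ᶠ x : D in nhds 0, x ∈ pPow p D m := hb.mem_of_mem trivial
      exact h1.mono fun y hy => mul_mem_pPow_right x hy
  exact { is_nonarchimedean := NonarchimedeanAddGroup.is_nonarchimedean }

theorem HasPSum.mul_antidiagonal {t t' : ℕ → D} {s s' : D}
    (h : HasPSum p t s) (h' : HasPSum p t' s') :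
    HasPSum p (fun n => ∑ x ∈ Finset.HasAntidiagonal.antidiagonal n, t x.1 * t' x.2) (s * s') := by
  let := padicTop p D
  have := padic_nonarchimedeanRing (p := p) (D := D)
  let : UniformSpace D := IsTopologicalAddGroup.rightUniformSpace D
  have : IsUniformAddGroup D := isUniformAddGroup_of_addCommGroup
  have h1 : HasSum (fun x : ℕ × ℕ => t x.1 * t' x.2) (s * s') := HasSum.mul_of_nonarchimedean h h'
  have h2 := (Finset.HasAntidiagonal.sigmaAntidiagonalEquivProd (A := ℕ)).hasSum_iff.2 h1
  refine HasSum.sigma h2 fun n => ?_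
  have h3 := hasSum_fintype (fun x : Finset.HasAntidiagonal.antidiagonal n => t x.1.1 * t' x.1.2)
  rw [Finset.sum_coe_sort (Finset.HasAntidiagonal.antidiagonal n) (fun x => t x.1 * t' x.2)] at h3
  exact h3

end PadicRing

/-! ### Evaluation of formal series in a `p`-adically complete ring -/

section Evaluation

variable {p : ℕ} [hp : Fact p.Prime]

theorem boldPMul_eq_pPow (L : Type*) [AddCommGroup L] [Module ℤ_[p] L] :
    boldPMul p L = pPow p L (boldExp p) := by
  rw [boldPMul, pPow, boldP_eq_pow, Nat.cast_pow]

theorem natCast_pow_smul_injective {V : Type*} [AddCommGroup V] [Module ℤ_[p] V] [Module ℚ_[p] V]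
    [IsScalarTower ℤ_[p] ℚ_[p] V] (s : ℕ) :
    Function.Injective fun x : V => (p : ℤ_[p]) ^ s • x := by
  intro x y h
  have hp0 : algebraMap ℤ_[p] ℚ_[p] ((p : ℤ_[p]) ^ s) ≠ 0 := by
    rw [map_pow, map_natCast]
    exact pow_ne_zero _ (Nat.cast_ne_zero.2 hp.out.ne_zero)
  simp only [← algebraMap_smul ℚ_[p] ((p : ℤ_[p]) ^ s)] at h
  exact smul_right_injective _ hp0 h

theorem HasPSum.smul {L : Type*} [AddCommGroup L] [Module ℤ_[p] L] {α : Type*} {t : α → L} {s : L}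
    (h : HasPSum p t s) (r : ℤ_[p]) : HasPSum p (fun i => r • t i) (r • s) := by
  rw [hasPSum_iff] at h ⊢
  intro m
  filter_upwards [h m] with F hF
  rw [← Finset.smul_sum, ← smul_sub]
  exact Submodule.smul_mem _ _ hF

theorem HasPSum.sum {L : Type*} [AddCommGroup L] [Module ℤ_[p] L] {α : Type*} {t : α → L}
    (F : Finset α) (h : ∀ i, i ∉ F → t i = 0) : HasPSum p t (∑ i ∈ F, t i) := by
  let := padicTop p L
  exact hasSum_sum_of_ne_finset_zero h

variable {D A : Type*} [Ring D] [Algebra ℤ_[p] D] [Ring A] [Algebra ℤ_[p] A]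

/-- The lattice `𝐩 ^ n D` in `A`. -/
noncomputable def boldLattice (φ : D →ₐ[ℤ_[p]] A) (n : ℕ) : Submodule ℤ_[p] A :=
  (pPow p D (boldExp p * n)).map φ.toLinearMap

variable {φ : D →ₐ[ℤ_[p]] A}

theorem mem_boldLattice {n : ℕ} {x : A} :
    x ∈ boldLattice φ n ↔ ∃ d : D, (p : ℤ_[p]) ^ (boldExp p * n) • φ d = x := by
  constructor
  · rintro ⟨_, ⟨d, rfl⟩, rfl⟩
    exact ⟨d, (map_smul φ _ d).symm⟩
  · rintro ⟨d, rfl⟩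
    exact ⟨_, ⟨d, rfl⟩, map_smul φ _ d⟩

theorem mul_mem_boldLattice (m n : ℕ) (x y : A) (hx : x ∈ boldLattice φ m)
    (hy : y ∈ boldLattice φ n) : x * y ∈ boldLattice φ (m + n) := by
  rw [mem_boldLattice] at hx hy ⊢
  obtain ⟨d, rfl⟩ := hx
  obtain ⟨e, rfl⟩ := hy
  exact ⟨d * e, by rw [smul_mul_smul_comm, map_mul, ← pow_add, mul_add]⟩

theorem mem_boldLattice_one {a : D} (ha : a ∈ boldPMul p D) : φ a ∈ boldLattice φ 1 := by
  rw [boldPMul_eq_pPow] at ha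
  exact ⟨a, by rwa [mul_one], rfl⟩

open PowerSeries

/-- The coefficients of `f` lie in `D`, and their sum is `s`. -/
def HasEval (φ : D →ₐ[ℤ_[p]] A) (f : PowerSeries A) (s : D) : Prop :=
  ∃ c : ℕ → D, (∀ n, φ (c n) = coeff n f) ∧ HasPSum p c s

theorem HasEval.unique [IsHausdorff (Ideal.span {(p : ℤ_[p])}) D] (hφ : Function.Injective φ)
    {f : PowerSeries A} {s s' : D} (h : HasEval φ f s) (h' : HasEval φ f s') : s = s' := by
  obtain ⟨c, hc, hs⟩ := h
  obtain ⟨c', hc', hs'⟩ := h'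
  obtain rfl : c = c' := funext fun n => hφ ((hc n).trans (hc' n).symm)
  exact eq_of_padicTendsto hs.hasPadicSum hs'.hasPadicSum

theorem HasEval.add {f g : PowerSeries A} {s s' : D} (h : HasEval φ f s) (h' : HasEval φ g s') :
    HasEval φ (f + g) (s + s') := by
  obtain ⟨c, hc, hs⟩ := h
  obtain ⟨c', hc', hs'⟩ := h'
  exact ⟨c + c', fun n => by simp [hc, hc'], hs.add hs'⟩

theorem HasEval.smul {f : PowerSeries A} {s : D} (h : HasEval φ f s) (r : ℤ_[p]) :
    HasEval φ (r • f) (r • s) := by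
  obtain ⟨c, hc, hs⟩ := h
  exact ⟨fun n => r • c n, fun n => by rw [map_smul, hc]; rfl, hs.smul r⟩

theorem HasEval.sub {f g : PowerSeries A} {s s' : D} (h : HasEval φ f s) (h' : HasEval φ g s') :
    HasEval φ (f - g) (s - s') := by
  have := h.add (h'.smul (-1))
  simpa [sub_eq_add_neg] using this

theorem HasEval.mul {f g : PowerSeries A} {s s' : D} (h : HasEval φ f s) (h' : HasEval φ g s') :
    HasEval φ (f * g) (s * s') := by
  obtain ⟨c, hc, hs⟩ := h
  obtain ⟨c', hc', hs'⟩ := h'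
  exact ⟨_, fun n => by simp [PowerSeries.coeff_mul, hc, hc'], hs.mul_antidiagonal hs'⟩

theorem hasEval_one : HasEval φ 1 1 := by
  refine ⟨fun n => if n = 0 then 1 else 0, fun n => ?_, hasPSum_single 0 fun j hj => if_neg hj⟩
  rw [PowerSeries.coeff_one]
  split_ifs with h <;> simp [h]

theorem HasEval.pow {f : PowerSeries A} {s : D} (h : HasEval φ f s) (k : ℕ) :
    HasEval φ (f ^ k) (s ^ k) := by
  induction k with
  | zero => simpa using hasEval_one
  | succ k ih => rw [pow_succ, pow_succ]; exact ih.mul h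

theorem hasEval_X_mul_C (a : D) : HasEval φ (PowerSeries.X * PowerSeries.C (φ a)) a := by
  have h : HasPSum p (fun n : ℕ => if n = 1 then a else 0) a := by
    have := hasPSum_single (p := p) (t := fun n : ℕ => if n = 1 then a else 0) 1
      fun j hj => if_neg hj
    simpa using this
  refine ⟨_, fun n => ?_, h⟩
  rcases n with _ | _ | n
  · simp
  · simp
  · rw [PowerSeries.coeff_succ_X_mul, PowerSeries.coeff_C]
    simp

variable [Algebra ℚ_[p] A] [IsScalarTower ℤ_[p] ℚ_[p] A]

/-- The condition `boldExp p ≤ m` gives membership in `𝐩D`, and `n ≤ 4 * m + 2` is a quantitative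
form of convergence to `0`. There is no extra division by `n` here, hence `r = 0`. -/
theorem exists_of_mem_denomSubmodule {n : ℕ} (hn : 1 ≤ n) {x : A}
    (hx : x ∈ denomSubmodule (boldLattice φ) n (n - 1)) :
    ∃ m, boldExp p ≤ m ∧ n ≤ 4 * m + 2 ∧ ∃ d ∈ pPow p D m, φ d = x := by
  obtain ⟨s, hs, hx⟩ := hx
  obtain ⟨d, hd⟩ := mem_boldLattice.1 hx
  obtain ⟨h1, h2⟩ := exponent_bounds hp.out hn hs (r := 0) (by simp) (by simpa using hn)
  refine ⟨boldExp p * n - s, by omega, by omega, _, ⟨d, rfl⟩,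
    natCast_pow_smul_injective (p := p) s ?_⟩
  have h3 : (p : ℤ_[p]) ^ (boldExp p * n) = p ^ s * p ^ (boldExp p * n - s) := by
    rw [← pow_add]; congr 1; omega
  simp only [LinearMap.lsmul_apply]
  rw [map_smul, smul_smul, ← h3, hd]

theorem HasSmallDenoms.exists_hasEval [IsPrecomplete (Ideal.span {(p : ℤ_[p])}) D]
    {f : PowerSeries A} (hf : HasSmallDenoms (boldLattice φ) f) :
    ∃ s ∈ boldPMul p D, HasEval φ f s := by
  have h : ∀ n, ∃ d : D, φ d = coeff n f ∧ ∃ m, boldExp p ≤ m ∧ n ≤ 4 * m + 2 ∧ d ∈ pPow p D m := by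
    intro n
    rcases Nat.eq_zero_or_pos n with rfl | hn
    · refine ⟨0, ?_, boldExp p, le_rfl, by omega, zero_mem _⟩
      rw [map_zero, coeff_zero_eq_constantCoeff_apply, hf.1]
    · obtain ⟨m, h1, h2, d, h3, h4⟩ := exists_of_mem_denomSubmodule hn (hf.2 n hn)
      exact ⟨d, h4, m, h1, h2, h3⟩
  choose c hc m hm1 hm2 hm3 using h
  obtain ⟨s, hs⟩ := exists_hasPSum (p := p) (t := c) (by
    intro M
    rw [Nat.cofinite_eq_atTop]
    filter_upwards [eventually_ge_atTop (4 * M + 2)] with n hn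
    exact pPow_anti p (by have := hm2 n; omega) (hm3 n))
  refine ⟨s, ?_, c, hc, hs⟩
  rw [boldPMul_eq_pPow]
  exact hs.mem fun n => pPow_anti p (hm1 n) (hm3 n)

/-- Composing formal series is compatible with evaluation. -/
theorem HasEval.ncSubst [IsAdicComplete (Ideal.span {(p : ℤ_[p])}) D] (hφ : Function.Injective φ)
    {f : PowerSeries A} (hf : HasSmallDenoms (boldLattice φ) f) {s : D} (hs : HasEval φ f s)
    {g : PowerSeries ℚ_[p]} (hg0 : constantCoeff g = 0)
    (hg : ∀ k, 1 ≤ k → HasDenom p (coeff k g) (k - 1)) :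
    ∃ (v : D) (t : ℕ → D), HasEval φ (ncSubst g f) v ∧ HasPSum p t v ∧
      ∀ k, φ (t k) = coeff k g • φ s ^ k := by
  have h : ∀ x : ℕ × ℕ, ∃ d : D, φ d = coeff x.1 g • coeff x.2 (f ^ x.1) ∧
      ∃ m, x.1 ≤ 4 * m + 2 ∧ x.2 ≤ 4 * m + 2 ∧ d ∈ pPow p D m := by
    rintro ⟨k, n⟩
    simp only
    rcases Nat.eq_zero_or_pos k with rfl | hk
    · refine ⟨0, ?_, n, by omega, by omega, zero_mem _⟩
      rw [coeff_zero_eq_constantCoeff_apply, hg0, zero_smul, map_zero]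
    rcases lt_or_ge n k with hnk | hnk
    -- The entry vanishes, so any exponent meeting both size conditions serves.
    · refine ⟨0, ?_, n + k, by omega, by omega, zero_mem _⟩
      rw [coeff_pow_eq_zero_of_lt hf.1 hnk, smul_zero, map_zero]
    · obtain ⟨m, -, h2, d, h3, h4⟩ := exists_of_mem_denomSubmodule (hk.trans_le hnk)
        (hf.smul_coeff_mem mul_mem_boldLattice hk (hk.trans_le hnk) (hg k hk))
      exact ⟨d, h4, m, hnk.trans h2, h2, h3⟩
  choose c hc m hm1 hm2 hm3 using h
  have hsmall : ∀ M, ∀ᶠ x in cofinite, c x ∈ pPow p D M := by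
    intro M
    rw [eventually_cofinite]
    refine ((Finset.range (4 * M + 2)) ×ˢ (Finset.range (4 * M + 2))).finite_toSet.subset ?_
    intro x hx
    have hlt : m x < M := by
      by_contra h
      exact hx (pPow_anti p (not_lt.1 h) (hm3 x))
    have h1 := hm1 x
    have h2 := hm2 x
    simp only [Finset.mem_coe, Finset.mem_product, Finset.mem_range]
    omega
  have hrow : ∀ k, ∃ t, HasPSum p (fun n => c (k, n)) t := fun k =>
    exists_hasPSum fun M =>
      (Prod.mk_right_injective k).tendsto_cofinite.eventually (hsmall M)
  choose t ht using hrow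
  obtain ⟨v, hv⟩ := exists_hasPSum hsmall
  refine ⟨v, t, ⟨fun n => ∑ k ∈ Finset.range (n + 1), c (k, n), fun n => ?_, ?_⟩,
    hv.prod_fiberwise ht, fun k => ?_⟩
  · rw [_root_.ncSubst, coeff_mk, map_sum]
    exact Finset.sum_congr rfl fun k _ => hc (k, n)
  -- Each column is a finite sum, since `f ^ k` has no coefficient in degree `n < k`.
  · refine hv.swap.prod_fiberwise fun n => HasPSum.sum _ fun k hk => hφ ?_
    rw [Prod.swap_prod_mk, hc, coeff_pow_eq_zero_of_lt hf.1 (by simpa using hk), smul_zero,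
      map_zero]
  · rcases Nat.eq_zero_or_pos k with rfl | hk
    · have h0 : HasPSum p (fun n => c (0, n)) 0 := by
        have := HasPSum.sum (p := p) (t := fun n => c (0, n)) ∅ fun n _ => hφ (by
          rw [hc, coeff_zero_eq_constantCoeff_apply, hg0, zero_smul, map_zero])
        simpa using this
      rw [eq_of_padicTendsto (ht 0).hasPadicSum h0.hasPadicSum, map_zero,
        coeff_zero_eq_constantCoeff_apply, hg0, zero_smul]
    -- The row sum should be `coeff k g • s ^ k`, but that scalar need not be integral. After
    -- multiplication by `p ^ j` the row becomes an integral multiple of `f ^ k`, whose value is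
    -- known; `p ^ j` is then cancelled in `A`.
    · obtain ⟨j, -, r, hr⟩ := hg k hk
      have hr' : ∀ x : A, (p : ℤ_[p]) ^ j • coeff k g • x = r • x := by
        intro x
        rw [← algebraMap_smul ℚ_[p] (_ ^ j) (coeff k g • x), smul_smul, map_pow, map_natCast, hr,
          ← algebraMap_smul ℚ_[p] r]
        rfl
      have h1 : HasEval φ (r • f ^ k) ((p : ℤ_[p]) ^ j • t k) :=
        ⟨_, fun n => by rw [map_smul, hc, hr']; rfl, (ht k).smul _⟩
      have h2 := h1.unique hφ ((hs.pow k).smul r)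
      refine natCast_pow_smul_injective (p := p) j ?_
      simp only
      rw [hr', ← map_smul, h2, map_smul, map_pow]

end Evaluation

/-! ### Exponentials and logarithms in `D` as values of formal series. -/

section ExpLogEvaluation

open PowerSeries

variable {p : ℕ} [hp : Fact p.Prime]
  {D A : Type*} [Ring D] [Algebra ℤ_[p] D] [Ring A] [Algebra ℤ_[p] A] [Algebra ℚ_[p] A]
  {φ : D →ₐ[ℤ_[p]] A}

theorem map_eq_inv_smul_iff (hφ : Function.Injective φ) {N : ℕ} (hN : N ≠ 0) {x y : D} :
    φ x = (N : ℚ_[p])⁻¹ • φ y ↔ N • x = y := by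
  have hN' : (N : ℚ_[p]) ≠ 0 := Nat.cast_ne_zero.2 hN
  rw [eq_inv_smul_iff₀ hN', Nat.cast_smul_eq_nsmul, ← map_nsmul]
  exact hφ.eq_iff

theorem isExpTerms_iff (hφ : Function.Injective φ) {a : D} {t : ℕ → D} :
    IsExpTerms a t ↔ ∀ n, φ (t n) = coeff n (formalExp ℚ_[p] (φ a)) := by
  refine forall_congr' fun n => ?_
  rw [formalExp, coeff_mk, ← map_pow, map_eq_inv_smul_iff hφ n.factorial_ne_zero]

theorem isLogTerms_iff (hφ : Function.Injective φ) {a : D} {t : ℕ → D} :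
    IsLogTerms a t ↔
      ∀ n, φ (t n) = coeff (n + 1) (PowerSeries.log ℚ_[p]) • φ a ^ (n + 1) := by
  refine forall_congr' fun n => ?_
  have h1 : coeff (n + 1) (PowerSeries.log ℚ_[p]) • φ a ^ (n + 1) =
      ((n + 1 : ℕ) : ℚ_[p])⁻¹ • φ ((-1) ^ n * a ^ (n + 1)) := by
    rw [coeff_log', pow_succ _ (n + 1), pow_succ _ n, div_eq_inv_mul, mul_smul, map_mul, map_pow,
      map_pow, map_neg, map_one]
    congr 1
    rcases neg_one_pow_eq_or ℚ_[p] n with h | h <;> rcases Nat.even_or_odd n with h' | h' <;>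
      simp [h'.neg_one_pow]
  rw [h1, map_eq_inv_smul_iff hφ n.succ_ne_zero]

theorem IsExp.unique [IsHausdorff (Ideal.span {(p : ℤ_[p])}) D]
    (hφ : Function.Injective φ) {a u u' : D} (h : IsExp p a u)
    (h' : IsExp p a u') : u = u' := by
  obtain ⟨t, ht, hs⟩ := h
  obtain ⟨t', ht', hs'⟩ := h'
  rw [isExpTerms_iff hφ] at ht ht'
  obtain rfl : t = t' := funext fun n => hφ ((ht n).trans (ht' n).symm)
  exact eq_of_padicTendsto hs hs'

theorem IsLog.unique [IsHausdorff (Ideal.span {(p : ℤ_[p])}) D]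
    (hφ : Function.Injective φ) {u v v' : D} (h : IsLog p u v)
    (h' : IsLog p u v') : v = v' := by
  obtain ⟨t, ht, hs⟩ := h
  obtain ⟨t', ht', hs'⟩ := h'
  rw [isLogTerms_iff hφ] at ht ht'
  obtain rfl : t = t' := funext fun n => hφ ((ht n).trans (ht' n).symm)
  exact eq_of_padicTendsto hs hs'

variable [IsScalarTower ℤ_[p] ℚ_[p] A]

theorem exists_isExpTerms (hφ : Function.Injective φ) {a : D} (ha : a ∈ boldPMul p D) :
    ∃ t : ℕ → D, IsExpTerms a t ∧ (∀ n, 1 ≤ n → t n ∈ boldPMul p D) ∧ PadicTendsto p t 0 := by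
  have hf := hasSmallDenoms_formalExp_sub_one mul_mem_boldLattice
    (mem_boldLattice_one (φ := φ) ha)
  have h : ∀ n, ∃ d : D, φ d = coeff n (formalExp ℚ_[p] (φ a)) ∧
      (1 ≤ n → ∃ m, boldExp p ≤ m ∧ n ≤ 4 * m + 2 ∧ d ∈ pPow p D m) := by
    intro n
    rcases Nat.eq_zero_or_pos n with rfl | hn
    · refine ⟨1, ?_, by simp⟩
      rw [coeff_zero_eq_constantCoeff_apply, constantCoeff_formalExp, map_one]
    · obtain ⟨m, h1, h2, d, h3, h4⟩ := exists_of_mem_denomSubmodule hn (hf.2 n hn)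
      refine ⟨d, ?_, fun _ => ⟨m, h1, h2, h3⟩⟩
      rw [h4, map_sub, PowerSeries.coeff_one, if_neg (by omega), sub_zero]
  choose t ht ht' using h
  refine ⟨t, (isExpTerms_iff hφ).2 ht, fun n hn => ?_, ?_⟩
  · obtain ⟨m, h1, -, h3⟩ := ht' n hn
    rw [boldPMul_eq_pPow]
    exact pPow_anti p h1 h3
  · refine (padic_tendsto_iff p).2 fun M => ?_
    filter_upwards [eventually_ge_atTop (4 * M + 2)] with n hn
    obtain ⟨m, -, h2, h3⟩ := ht' n (by omega)
    rw [sub_zero]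
    exact pPow_anti p (by omega) h3

variable [IsAdicComplete (Ideal.span {(p : ℤ_[p])}) D]

/-- The composition theorem needs series without constant term, so it is applied to `e ^ X - 1` and
the term `1` is restored afterwards. -/
theorem HasEval.isExp (hφ : Function.Injective φ) {f : PowerSeries A}
    (hf : HasSmallDenoms (boldLattice φ) f) {s u : D} (hs : HasEval φ f s)
    (hu : HasEval φ (expOf ℚ_[p] f) u) : IsExp p s u := by
  obtain ⟨v, t, hv, ht, htk⟩ := hs.ncSubst hφ hf (constantCoeff_expSubOne _)
    fun _ hk => hasDenom_coeff_expSubOne hk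
  have h1 : u = 1 + v := by
    refine hu.unique hφ ?_
    rw [expOf_eq]
    exact hasEval_one.add hv
  have h2 : HasPSum p (fun n : ℕ => if n = 0 then (1 : D) else 0) 1 :=
    hasPSum_single 0 fun j hj => if_neg hj
  refine ⟨_, (isExpTerms_iff hφ).2 fun n => ?_, h1 ▸ (h2.add ht).hasPadicSum⟩
  rw [Pi.add_apply, map_add, htk, formalExp, coeff_mk, expSubOne, map_sub, coeff_exp',
    PowerSeries.coeff_one]
  split_ifs with h <;> simp [h]

theorem HasEval.isLog (hφ : Function.Injective φ) {f : PowerSeries A}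
    (hf : HasSmallDenoms (boldLattice φ) f) {s v : D} (hs : HasEval φ f s)
    (hv : HasEval φ (logOneAdd ℚ_[p] f) v) : IsLog p (1 + s) v := by
  obtain ⟨v', t, hv', ht, htk⟩ := hs.ncSubst (g := PowerSeries.log ℚ_[p]) hφ hf (by simp)
    fun _ hk => hasDenom_coeff_log hk
  obtain rfl : v = v' := hv.unique hφ hv'
  -- `IsLogTerms` begins in degree one, so the index is shifted; the dropped term is `0`.
  have h0 : t 0 = 0 := hφ (by rw [htk, coeff_log']; simp)
  refine ⟨t ∘ Nat.succ, (isLogTerms_iff hφ).2 fun n => ?_,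
    (ht.comp_injective Nat.succ_injective ?_).hasPadicSum⟩
  · rw [add_sub_cancel_left]; exact htk (n + 1)
  · intro b hb
    obtain rfl : b = 0 := by
      by_contra h
      exact hb ⟨b - 1, Nat.succ_pred h⟩
    exact h0

theorem exists_hasEval_formalExp {a : D} (ha : a ∈ boldPMul p D) :
    ∃ u, u - 1 ∈ boldPMul p D ∧ HasEval φ (formalExp ℚ_[p] (φ a)) u := by
  obtain ⟨s, hs, h⟩ := (hasSmallDenoms_formalExp_sub_one mul_mem_boldLattice
    (mem_boldLattice_one (φ := φ) ha)).exists_hasEval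
  refine ⟨1 + s, by rwa [add_sub_cancel_left], ?_⟩
  have := (hasEval_one (φ := φ)).add h
  rwa [add_sub_cancel] at this

theorem isExp_iff_hasEval (hφ : Function.Injective φ) {a : D} (ha : a ∈ boldPMul p D) {u : D} :
    IsExp p a u ↔ HasEval φ (formalExp ℚ_[p] (φ a)) u := by
  have h : ∀ u, HasEval φ (formalExp ℚ_[p] (φ a)) u → IsExp p a u := fun u hu => by
    rw [formalExp_eq_expOf] at hu
    exact (hasEval_X_mul_C a).isExp hφ (hasSmallDenoms_X_mul_C (mem_boldLattice_one ha)) hu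
  refine ⟨fun hu => ?_, h u⟩
  obtain ⟨u', -, hu'⟩ := exists_hasEval_formalExp (φ := φ) ha
  rwa [hu.unique hφ (h u' hu')]

theorem exists_hasEval_logOneAdd {a : D} (ha : a ∈ boldPMul p D) :
    ∃ v ∈ boldPMul p D, HasEval φ (logOneAdd ℚ_[p] (PowerSeries.X * PowerSeries.C (φ a))) v :=
  ((hasSmallDenoms_X_mul_C (mem_boldLattice_one ha)).logOneAdd mul_mem_boldLattice).exists_hasEval

theorem isLog_iff_hasEval (hφ : Function.Injective φ) {a : D} (ha : a ∈ boldPMul p D) {v : D} :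
    IsLog p (1 + a) v ↔
      HasEval φ (logOneAdd ℚ_[p] (PowerSeries.X * PowerSeries.C (φ a))) v := by
  have h := fun v => (hasEval_X_mul_C (φ := φ) a).isLog (v := v) hφ
    (hasSmallDenoms_X_mul_C (mem_boldLattice_one ha))
  refine ⟨fun hv => ?_, h v⟩
  obtain ⟨v', -, hv'⟩ := exists_hasEval_logOneAdd (φ := φ) ha
  rwa [hv.unique hφ (h v' hv')]

/-- Take `f = e ^ (t a) - 1`: its value is `u - 1`, and its formal logarithm `t a` has the value
`a`. -/
theorem isLog_of_isExp (hφ : Function.Injective φ) {a u : D} (ha : a ∈ boldPMul p D)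
    (hu : IsExp p a u) : IsLog p u a := by
  have h1 := ((isExp_iff_hasEval hφ ha).1 hu).sub hasEval_one
  have h2 := h1.isLog (v := a) hφ
    (hasSmallDenoms_formalExp_sub_one mul_mem_boldLattice (mem_boldLattice_one ha)) (by
      rw [formalExp_eq_expOf, logOneAdd_expOf _ (by simp)]
      exact hasEval_X_mul_C a)
  rwa [add_sub_cancel] at h2

theorem isExp_of_isLog (hφ : Function.Injective φ) {a v : D} (ha : a ∈ boldPMul p D)
    (hv : IsLog p (1 + a) v) : IsExp p v (1 + a) := by
  refine ((isLog_iff_hasEval hφ ha).1 hv).isExp hφ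
    ((hasSmallDenoms_X_mul_C (mem_boldLattice_one ha)).logOneAdd mul_mem_boldLattice) ?_
  rw [expOf_logOneAdd _ (by simp)]
  exact hasEval_one.add (hasEval_X_mul_C a)

theorem isExp_zero (hφ : Function.Injective φ) : IsExp p (0 : D) 1 := by
  rw [isExp_iff_hasEval hφ (zero_mem _), map_zero, formalExp_zero]
  exact hasEval_one

theorem isExp_one_iff (hφ : Function.Injective φ) {a : D} (ha : a ∈ boldPMul p D) :
    IsExp p a 1 ↔ a = 0 := by
  refine ⟨fun h => ?_, fun h => h ▸ isExp_zero hφ⟩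
  exact (isLog_of_isExp hφ ha h).unique hφ (isLog_of_isExp hφ (zero_mem _) (isExp_zero hφ))

theorem isExp_injective (hφ : Function.Injective φ) {a b u : D} (ha : a ∈ boldPMul p D)
    (hb : b ∈ boldPMul p D) (hau : IsExp p a u) (hbu : IsExp p b u) : a = b :=
  (isLog_of_isExp hφ ha hau).unique hφ (isLog_of_isExp hφ hb hbu)

theorem isExp_neg_mul (hφ : Function.Injective φ) {a u w : D} (ha : a ∈ boldPMul p D)
    (hu : IsExp p a u) (hw : IsExp p (-a) w) : u * w = 1 := by
  have h := ((isExp_iff_hasEval hφ ha).1 hu).mul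
    ((isExp_iff_hasEval hφ (neg_mem ha)).1 hw)
  rw [← formalExp_add _ (by rw [map_neg]; exact (Commute.refl _).neg_right), ← map_add,
    add_neg_cancel, map_zero, formalExp_zero] at h
  exact h.unique hφ hasEval_one

/-- If the `H_n(a, b)` have the sum `c`, then `e ^ c = e ^ a * e ^ b`. -/
theorem isExp_bch (hφ : Function.Injective φ) {a b u w c : D} (ha : a ∈ boldPMul p D)
    (hb : b ∈ boldPMul p D) (hu : IsExp p a u) (hw : IsExp p b w) {h : ℕ → D}
    (hh : ∀ n, φ (h n) = bchAt ℚ_[p] (φ a) (φ b) n) (hc : HasPSum p h c) :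
    IsExp p c (u * w) := by
  have h1 := hasSmallDenoms_formalExp_mul_sub_one mul_mem_boldLattice
    (mem_boldLattice_one (φ := φ) ha) (mem_boldLattice_one hb)
  refine HasEval.isExp hφ (h1.logOneAdd mul_mem_boldLattice) ⟨h, hh, hc⟩ ?_
  rw [expOf_logOneAdd _ h1.1, add_sub_cancel]
  exact ((isExp_iff_hasEval hφ ha).1 hu).mul ((isExp_iff_hasEval hφ hb).1 hw)

end ExpLogEvaluation

/-! ### Integrality of the Baker-Campbell-Hausdorff series -/

section LieIntegrality

variable {p : ℕ} [hp : Fact p.Prime]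

/-- On words of length `n ≥ 1`, the Dynkin map at elements of `q L` takes values in `q ^ n L`. -/
theorem dynkinAct_freeWord {L : Type*} [LieRing L] [LieAlgebra ℤ_[p] L] {ι : Type*} (q : ℤ_[p])
    {ℓ : ι → ℚ_[p] ⊗[ℤ_[p]] L} {a : ι → L} (hℓ : ∀ i, ℓ i = (1 : ℚ_[p]) ⊗ₜ[ℤ_[p]] (q • a i))
    (i : ι) (l : List ι) :
    ∃ m : L, dynkinAct ℚ_[p] ℓ (freeWord ℚ_[p] (i :: l)) (0, 1) =
      ((1 : ℚ_[p]) ⊗ₜ[ℤ_[p]] (q ^ (l.length + 1) • m), 0) := by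
  have hcons : ∀ (i : ι) (l : List ι), dynkinAct ℚ_[p] ℓ (freeWord ℚ_[p] (i :: l)) (0, 1) =
      dynkinStep ℚ_[p] (ℓ i) (dynkinAct ℚ_[p] ℓ (freeWord ℚ_[p] l) (0, 1)) := by
    intro i l
    have : freeWord ℚ_[p] (i :: l) = FreeAlgebra.ι ℚ_[p] i * freeWord ℚ_[p] l := by simp [freeWord]
    rw [this, map_mul, Module.End.mul_apply, dynkinAct, FreeAlgebra.lift_ι_apply]
  induction l generalizing i with
  | nil =>
    refine ⟨a i, ?_⟩
    rw [hcons, dynkinStep_apply]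
    simp [freeWord, hℓ]
  | cons j l ih =>
    obtain ⟨m, hm⟩ := ih j
    refine ⟨⁅a i, m⁆, ?_⟩
    rw [hcons, hm, dynkinStep_apply, hℓ, LieAlgebra.ExtendScalars.bracket_tmul, zero_smul, add_zero,
      mul_one, smul_lie, lie_smul, smul_smul, List.length_cons, ← pow_succ']

theorem dynkin_mem_of_mem_wordLattice {L : Type*} [LieRing L] [LieAlgebra ℤ_[p] L] {ι : Type*}
    (q : ℤ_[p]) {ℓ : ι → ℚ_[p] ⊗[ℤ_[p]] L} {a : ι → L}
    (hℓ : ∀ i, ℓ i = (1 : ℚ_[p]) ⊗ₜ[ℤ_[p]] (q • a i)) {n : ℕ} (hn : 1 ≤ n)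
    {u : FreeAlgebra ℚ_[p] ι} (hu : u ∈ wordLattice p ι n) :
    ∃ m : L, dynkin ℚ_[p] ℓ u = (1 : ℚ_[p]) ⊗ₜ[ℤ_[p]] (q ^ n • m) := by
  induction hu using Submodule.span_induction with
  | mem x hx =>
    obtain ⟨l, rfl, rfl⟩ := hx
    obtain ⟨i, l, rfl⟩ := List.exists_cons_of_length_pos hn
    obtain ⟨m, hm⟩ := dynkinAct_freeWord q hℓ i l
    exact ⟨m, by rw [dynkin_apply, hm]; rfl⟩
  | zero => exact ⟨0, by simp⟩
  | add x y _ _ hx hy =>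
    obtain ⟨m, hm⟩ := hx
    obtain ⟨m', hm'⟩ := hy
    exact ⟨m + m', by rw [map_add, hm, hm', smul_add, TensorProduct.tmul_add]⟩
  | smul c x _ hx =>
    obtain ⟨m, hm⟩ := hx
    refine ⟨c • m, ?_⟩
    rw [← algebraMap_smul ℚ_[p] c x, map_smul, hm, algebraMap_smul, smul_comm _ c m,
      TensorProduct.tmul_smul c]

/-- The values of `H_n` at elements of `𝐩L` lie in `𝐩L` and tend to `0`. -/
theorem exists_isBCHTerm {L : Type*} [LieRing L] [LieAlgebra ℤ_[p] L] {a b : L}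
    (ha : a ∈ boldPMul p L) (hb : b ∈ boldPMul p L) (n : ℕ) :
    ∃ c : L, IsBCHTerm p n a b c ∧
      ∃ m, boldExp p ≤ m ∧ n ≤ 4 * m + 2 ∧ c ∈ pPow p L m := by
  rcases Nat.eq_zero_or_pos n with rfl | hn
  · refine ⟨0, ⟨bchLieWord p 0, lieWordToAssoc_bchLieWord 0, ?_⟩,
      boldExp p, le_rfl, by omega, zero_mem _⟩
    simp [bchLieWord]
  obtain ⟨a, rfl⟩ := ha
  obtain ⟨b, rfl⟩ := hb
  simp only [LinearMap.lsmul_apply]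
  set q : ℤ_[p] := (boldP p : ℤ_[p]) with hq
  let ℓ : Fin 2 → ℚ_[p] ⊗[ℤ_[p]] L :=
    ![(1 : ℚ_[p]) ⊗ₜ[ℤ_[p]] (q • a), (1 : ℚ_[p]) ⊗ₜ[ℤ_[p]] (q • b)]
  have hℓ : ∀ i, ℓ i = (1 : ℚ_[p]) ⊗ₜ[ℤ_[p]] (q • (![a, b] : Fin 2 → L) i) := by
    intro i; fin_cases i <;> rfl
  obtain ⟨s, hs, hmem⟩ := bchComponent_mem_denomSubmodule (p := p) hn
  obtain ⟨m, hm⟩ := dynkin_mem_of_mem_wordLattice q hℓ hn hmem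
  -- `s` clears the denominators of `H_n` as a combination of words, and `r` those of the factor `1
  -- / n` in Dynkin's formula. Both are taken out of `𝐩 ^ n`.
  set r := padicValNat p n with hr
  have hr1 : r * (p - 1) ≤ n - 1 := padicValNat_mul_le (by omega)
  have hr2 : p ^ r ≤ n := Nat.le_of_dvd hn pow_padicValNat_dvd
  obtain ⟨ρ, hρ⟩ := exists_pow_mul_inv_natCast (p := p) (show n ≠ 0 by omega)
  obtain ⟨h1, h2⟩ := exponent_bounds hp.out hn hs hr1 hr2
  set e := boldExp p * n - (s + r) with he
  refine ⟨(p : ℤ_[p]) ^ e • ρ • m, ⟨bchLieWord p n, lieWordToAssoc_bchLieWord n, ?_⟩,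
    e, by omega, by omega, ⟨_, rfl⟩⟩
  have h3 : evalLieWord p (q • a) (q • b) (bchLieWord p n) =
      (n : ℚ_[p])⁻¹ • dynkin ℚ_[p] ℓ (bchComponent ℚ_[p] n) := by
    rw [bchLieWord, map_smul, map_dynkin]
    have : (fun i => evalLieWord p (q • a) (q • b) (FreeLieAlgebra.of ℚ_[p] i)) = ℓ := by
      funext i; simp [evalLieWord, ℓ]
    rw [this]
  refine natCast_pow_smul_injective (p := p) (s + r) ?_
  simp only
  have h4 : (p : ℤ_[p]) ^ r • (n : ℚ_[p])⁻¹ • dynkin ℚ_[p] ℓ ((p : ℤ_[p]) ^ s •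
      bchComponent ℚ_[p] n) = ρ • dynkin ℚ_[p] ℓ ((p : ℤ_[p]) ^ s • bchComponent ℚ_[p] n) := by
    rw [← algebraMap_smul ℚ_[p] ((p : ℤ_[p]) ^ r), smul_smul, map_pow, map_natCast, hρ,
      ← algebraMap_smul ℚ_[p] ρ]
    rfl
  have h5 : dynkin ℚ_[p] ℓ ((p : ℤ_[p]) ^ s • bchComponent ℚ_[p] n) =
      (p : ℤ_[p]) ^ s • dynkin ℚ_[p] ℓ (bchComponent ℚ_[p] n) := by
    rw [← algebraMap_smul ℚ_[p] ((p : ℤ_[p]) ^ s), map_smul, algebraMap_smul]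
  have h6 : (p : ℤ_[p]) ^ (s + r) * (p : ℤ_[p]) ^ e = q ^ n := by
    rw [← pow_add, hq, boldP_eq_pow, Nat.cast_pow, ← pow_mul]
    congr 1
    omega
  rw [h3, add_comm s r, pow_add, mul_smul, smul_comm _ (n : ℚ_[p])⁻¹, ← h5, h4, hm,
    ← TensorProduct.tmul_smul, ← mul_smul, ← TensorProduct.tmul_smul, smul_smul, smul_smul,
    ← pow_add, add_comm r s, h6, mul_comm]

end LieIntegrality

/-! ### Closed Lie subalgebras and the sum of the series `H(a, b)`. -/

section ClosedSubalgebra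

variable {p : ℕ} [hp : Fact p.Prime]

theorem coe_mem_pPow {L : Type*} [AddCommGroup L] [Module ℤ_[p] L] {M : Submodule ℤ_[p] L} {x : M}
    {m : ℕ} (hx : x ∈ pPow p M m) : (x : L) ∈ pPow p L m := by
  obtain ⟨y, rfl⟩ := hx
  exact ⟨y, rfl⟩

theorem HasPSum.coe {L : Type*} [AddCommGroup L] [Module ℤ_[p] L] {M : Submodule ℤ_[p] L}
    {α : Type*} {t : α → M} {s : M} (h : HasPSum p t s) :
    HasPSum p (fun i => (t i : L)) (s : L) := by
  rw [hasPSum_iff] at h ⊢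
  intro m
  filter_upwards [h m] with F hF
  simpa using coe_mem_pPow hF

/-- A closed submodule of a complete torsion-free module is complete for its own filtration. -/
theorem isPrecomplete_of_isClosed {L : Type*} [AddCommGroup L] [Module ℤ_[p] L]
    [Module.IsTorsionFree ℤ_[p] L] [hL : IsPrecomplete (Ideal.span {(p : ℤ_[p])}) L]
    {M : Submodule ℤ_[p] L} (hM : @IsClosed L (padicTop p L) (M : Set L)) :
    IsPrecomplete (Ideal.span {(p : ℤ_[p])}) M := by
  refine ⟨fun f hf => ?_⟩
  have hf' : ∀ {m n}, m ≤ n → f n - f m ∈ pPow p M m := by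
    intro m n hmn
    have := (hf hmn).symm
    rwa [span_pow_smul_top, SModEq.sub_mem] at this
  obtain ⟨x, hx⟩ := hL.prec (f := fun n => (f n : L)) (by
    intro m n hmn
    rw [span_pow_smul_top]
    exact (SModEq.sub_mem.2 (coe_mem_pPow (hf' hmn))).symm)
  have hx' : ∀ n, (f n : L) - x ∈ pPow p L n := by
    intro n
    have := hx n
    rwa [span_pow_smul_top, SModEq.sub_mem] at this
  have htend : PadicTendsto p (fun n => (f n : L)) x := (padic_tendsto_iff p).2 fun m => by
    filter_upwards [eventually_ge_atTop m] with n hn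
    exact pPow_anti p hn (hx' n)
  have hxM : x ∈ M := PadicTendsto.mem_of_isClosed hM htend fun n => (f n).2
  refine ⟨⟨x, hxM⟩, fun n => ?_⟩
  rw [span_pow_smul_top]
  have hinj : Function.Injective fun y : L => (p : ℤ_[p]) ^ n • y :=
    Module.IsTorsionFree.isSMulRegular (IsRegular.of_ne_zero
      (pow_ne_zero _ (Nat.cast_ne_zero.2 hp.out.ne_zero)))
  -- The module `p ^ n M` may be smaller than the intersection of `M` with `p ^ n D`-type
  -- neighbourhoods, so closeness in `L` is not enough. The quotients `(f (n + k) - f n) / p ^ n`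
  -- exist in `M`; their limit in `L` is `-z`, which lies in `M` because `M` is closed.
  have h1 : ∀ k, ∃ y : M, (p : ℤ_[p]) ^ n • y = f (n + k) - f n := fun k =>
    hf' (Nat.le_add_right n k)
  choose y hy using h1
  obtain ⟨z, hz⟩ := hx' n
  simp only [LinearMap.lsmul_apply] at hz
  have hyz : PadicTendsto p (fun k => (y k : L)) (-z) := (padic_tendsto_iff p).2 fun m => by
    filter_upwards [eventually_ge_atTop m] with k hk
    obtain ⟨w, hw⟩ := hx' (n + k)
    simp only [LinearMap.lsmul_apply] at hw
    refine pPow_anti p hk ⟨w, hinj ?_⟩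
    have h2 := congrArg (Subtype.val) (hy k)
    simp only [LinearMap.lsmul_apply, Submodule.coe_smul, Submodule.coe_sub, smul_sub, smul_neg]
      at h2 ⊢
    rw [smul_smul, ← pow_add, hw, h2, hz]
    abel
  have hzM : -z ∈ M := PadicTendsto.mem_of_isClosed hM hyz fun k => (y k).2
  refine SModEq.sub_mem.2 ⟨-⟨-z, hzM⟩, Subtype.ext ?_⟩
  simp [hz]

variable {D A : Type*} [Ring D] [Algebra ℤ_[p] D] [Ring A] [Algebra ℤ_[p] A] [Algebra ℚ_[p] A]
  [IsScalarTower ℤ_[p] ℚ_[p] A]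

/-- The Lie algebra homomorphism `ℚ_p ⊗ M → A` extending `M → D → A`. -/
noncomputable def extendToAssoc (φ : D →ₐ[ℤ_[p]] A) (M : LieSubalgebra ℤ_[p] D) :
    ℚ_[p] ⊗[ℤ_[p]] M →ₗ⁅ℚ_[p]⁆ A where
  toLinearMap := LinearMap.liftBaseChange ℚ_[p] (φ.toLinearMap ∘ₗ M.toSubmodule.subtype)
  map_lie' := by
    intro x y
    simp only [AddHom.toFun_eq_coe, LinearMap.coe_toAddHom]
    induction x using TensorProduct.induction_on with
    | zero => simp
    | add x x' hx hx' => rw [add_lie, map_add, hx, hx', map_add, add_lie]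
    | tmul s x =>
      induction y using TensorProduct.induction_on with
      | zero => simp
      | add y y' hy hy' => rw [lie_add, map_add, hy, hy', map_add, lie_add]
      | tmul t y =>
        rw [LieAlgebra.ExtendScalars.bracket_tmul]
        have hbr : φ (M.toSubmodule.subtype ⁅x, y⁆) =
            φ (M.toSubmodule.subtype x) * φ (M.toSubmodule.subtype y) -
              φ (M.toSubmodule.subtype y) * φ (M.toSubmodule.subtype x) := by
          change φ ((x : D) * y - y * x) = _
          rw [map_sub, map_mul, map_mul]
          rfl
        simp only [LinearMap.liftBaseChange_tmul, LinearMap.comp_apply, AlgHom.toLinearMap_apply,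
          hbr, LieRing.of_associative_ring_bracket, smul_mul_smul_comm, smul_sub, mul_comm s t]

theorem extendToAssoc_tmul (φ : D →ₐ[ℤ_[p]] A) (M : LieSubalgebra ℤ_[p] D) (x : M) :
    extendToAssoc φ M ((1 : ℚ_[p]) ⊗ₜ[ℤ_[p]] x) = φ x := by
  change LinearMap.liftBaseChange ℚ_[p] (φ.toLinearMap ∘ₗ M.toSubmodule.subtype) _ = _
  simp

/-- The value of a Lie word `H_n` at elements of a Lie subalgebra `M` of `D` is the coefficient of
degree `n` in `log (e ^ (t a) * e ^ (t b))`. -/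
theorem IsBCHTerm.map_eq {φ : D →ₐ[ℤ_[p]] A} {M : LieSubalgebra ℤ_[p] D} {a b c : M} {n : ℕ}
    (h : IsBCHTerm p n a b c) : φ c = bchAt ℚ_[p] (φ a) (φ b) n := by
  obtain ⟨w, hw, hc⟩ := h
  have key : (extendToAssoc φ M).comp (evalLieWord p a b) =
      (AlgHom.toLieHom (FreeAlgebra.lift ℚ_[p] ![φ a, φ b])).comp (lieWordToAssoc ℚ_[p]) := by
    refine FreeLieAlgebra.hom_ext fun i => ?_
    fin_cases i <;> simp [evalLieWord, lieWordToAssoc, extendToAssoc_tmul]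
  have h1 := LieHom.congr_fun key w
  rw [LieHom.comp_apply, LieHom.comp_apply, hc, hw, extendToAssoc_tmul] at h1
  rw [h1]
  exact lift_bchComponent ℚ_[p] ![φ a, φ b] n

/-- The series is summed in the topology of `M` itself. The inclusion into `D` preserves the sum,
and there the formal identity `e ^ (log (1 + f)) = 1 + f` with `1 + f = e ^ (t a) * e ^ (t b)`
applies. -/
theorem exists_isBCH [Module.IsTorsionFree ℤ_[p] D]
    [IsAdicComplete (Ideal.span {(p : ℤ_[p])}) D] {φ : D →ₐ[ℤ_[p]] A}
    (hφ : Function.Injective φ) {M : LieSubalgebra ℤ_[p] D}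
    (hM : @IsClosed D (padicTop p D) (M : Set D)) {a b : M} (ha : a ∈ boldPMul p M)
    (hb : b ∈ boldPMul p M) : ∃ c ∈ boldPMul p M, IsBCH p a b c ∧
      ∀ u w : D, IsExp p (a : D) u → IsExp p (b : D) w → IsExp p (c : D) (u * w) := by
  have : IsPrecomplete (Ideal.span {(p : ℤ_[p])}) M :=
    isPrecomplete_of_isClosed (M := M.toSubmodule) hM
  choose h hh m hm1 hm2 hm3 using exists_isBCHTerm ha hb
  obtain ⟨c, hc⟩ := exists_hasPSum (p := p) (t := h) (by
    intro N
    rw [Nat.cofinite_eq_atTop]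
    filter_upwards [eventually_ge_atTop (4 * N + 2)] with n hn
    exact pPow_anti p (by have := hm2 n; omega) (hm3 n))
  have hcoe : ∀ {x : M}, x ∈ boldPMul p M → (x : D) ∈ boldPMul p D := by
    rintro _ ⟨y, rfl⟩
    exact ⟨y, rfl⟩
  refine ⟨c, ?_, ⟨h, hh, hc.hasPadicSum⟩, fun u w hu hw => ?_⟩
  · rw [boldPMul_eq_pPow]
    exact hc.mem fun n => pPow_anti p (hm1 n) (hm3 n)
  · exact isExp_bch hφ (hcoe ha) (hcoe hb) hu hw (fun n => (hh n).map_eq)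
      (HasPSum.coe (M := M.toSubmodule) hc)

end ClosedSubalgebra

/-! ### The group `Γ(𝐩M)` -/

section MainTheorem

variable {p : ℕ} [hp : Fact p.Prime]

/-- The group structure on `𝐩M` is pulled back from the units along the injective map `a ↦ e ^ a`,
so associativity and inverses for `H` need no computation with the series. -/
theorem exists_bchGroup {D A : Type*} [Ring D] [Algebra ℤ_[p] D] [Ring A] [Algebra ℤ_[p] A]
    [Algebra ℚ_[p] A] [IsScalarTower ℤ_[p] ℚ_[p] A] [Module.IsTorsionFree ℤ_[p] D]
    [IsAdicComplete (Ideal.span {(p : ℤ_[p])}) D] {φ : D →ₐ[ℤ_[p]] A}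
    (hφ : Function.Injective φ) (M : LieSubalgebra ℤ_[p] D)
    (hM : @IsClosed D (padicTop p D) (M : Set D)) :
    ∃ (G : Group (boldPMul p M)) (S : Subgroup Dˣ),
      IsBCHGroup p M G ∧
      ((fun s : Dˣ => (s : D)) '' (S : Set Dˣ)) =
        {u : D | ∃ a ∈ boldPMul p M, IsExp p (a : D) u} ∧
      ∃ ψ : boldPMul p M ≃* S, ∀ a : boldPMul p M, IsExp p ((a : M) : D) ((ψ a : Dˣ) : D) := by
  have hcoe : ∀ x : boldPMul p M, ((x : M) : D) ∈ boldPMul p D := by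
    rintro ⟨_, y, rfl⟩
    exact ⟨y, rfl⟩
  have hex : ∀ a : boldPMul p M, ∃ u, IsExp p ((a : M) : D) u := fun a => by
    obtain ⟨u, -, hu⟩ := exists_hasEval_formalExp (φ := φ) (hcoe a)
    exact ⟨u, (isExp_iff_hasEval hφ (hcoe a)).2 hu⟩
  choose E hE using hex
  have hneg : ∀ a, E a * E (-a) = 1 := fun a => isExp_neg_mul hφ (hcoe a) (hE a) (hE (-a))
  have hneg' : ∀ a, E (-a) * E a = 1 := fun a => by simpa using hneg (-a)
  let U : boldPMul p M → Dˣ := fun a => ⟨E a, E (-a), hneg a, hneg' a⟩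
  have hU : Function.Injective U := fun a b hab => by
    have h1 : E a = E b := congrArg Units.val hab
    exact Subtype.ext (Subtype.ext (isExp_injective hφ (hcoe a) (hcoe b) (hE a) (h1 ▸ hE b)))
  have hmul : ∀ a b : boldPMul p M, ∃ c : boldPMul p M,
      IsBCH p (a : M) (b : M) (c : M) ∧ U c = U a * U b := fun a b => by
    obtain ⟨c, hc, h1, h2⟩ := exists_isBCH hφ hM a.2 b.2
    exact ⟨⟨c, hc⟩, h1, Units.ext ((hE ⟨c, hc⟩).unique hφ (h2 _ _ (hE a) (hE b)))⟩
  let S : Subgroup Dˣ :=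
    { carrier := Set.range U
      mul_mem' := by
        rintro _ _ ⟨a, rfl⟩ ⟨b, rfl⟩
        obtain ⟨c, -, hc⟩ := hmul a b
        exact ⟨c, hc⟩
      one_mem' := ⟨0, Units.ext ((hE 0).unique hφ (isExp_zero hφ))⟩
      inv_mem' := by
        rintro _ ⟨a, rfl⟩
        exact ⟨-a, Units.ext rfl⟩ }
  let e : boldPMul p M ≃ S := Equiv.ofInjective U hU
  have he : ∀ a, ((e a : S) : Dˣ) = U a := fun a => rfl
  let G : Group (boldPMul p M) := e.group
  have hG : ∀ a b, e (G.mul a b) = e a * e b := fun a b => e.apply_symm_apply _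
  refine ⟨G, S, fun a b => ?_, ?_, ⟨e, hG⟩, fun a => hE a⟩
  · obtain ⟨c, h1, h2⟩ := hmul a b
    -- The pulled-back product and `H(a, b)` have the same exponential, so they agree by
    -- injectivity.
    have h3 : G.mul a b = c := e.injective (Subtype.ext (by rw [hG, he, h2]; rfl))
    rwa [h3]
  · ext u
    constructor
    · rintro ⟨_, ⟨a, rfl⟩, rfl⟩
      exact ⟨a, a.2, hE a⟩
    · rintro ⟨a, ha, hu⟩
      exact ⟨U ⟨a, ha⟩, ⟨_, rfl⟩, (hE ⟨a, ha⟩).unique hφ hu⟩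

end MainTheorem

theorem mainTheorem8 (p : ℕ) [Fact p.Prime] (D : Type*) [Ring D] [Algebra ℤ_[p] D]
    [Module.IsTorsionFree ℤ_[p] D] [IsAdicComplete (Ideal.span {(p : ℤ_[p])}) D] :
    -- (i) `a ^ n / n!` lies in `𝐩D` and tends to `0`; `e ^ a ∈ 1 + 𝐩D` and `log (1 + a) ∈ 𝐩D`
    (∀ a ∈ boldPMul p D,
      (∃ t : ℕ → D, IsExpTerms a t ∧ (∀ n, 1 ≤ n → t n ∈ boldPMul p D) ∧ PadicTendsto p t 0) ∧
      (∃! u : D, IsExp p a u) ∧ (∀ u : D, IsExp p a u → u - 1 ∈ boldPMul p D) ∧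
      (∃! v : D, IsLog p (1 + a) v) ∧ (∀ v : D, IsLog p (1 + a) v → v ∈ boldPMul p D)) ∧
    -- (ii) `log (e ^ a) = a` and `e ^ (log (1 + a)) = 1 + a`; `e ^ a = 1` only for `a = 0`
    (∀ a ∈ boldPMul p D,
      (∀ u : D, IsExp p a u → IsLog p u a) ∧
      (∀ v : D, IsLog p (1 + a) v → IsExp p v (1 + a)) ∧
      (IsExp p a 1 ↔ a = 0)) ∧
    -- (iii) `{e ^ a | a ∈ 𝐩M}` is a group, isomorphic to `Γ(𝐩M)` by `a ↦ e ^ a`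
    (∀ M : LieSubalgebra ℤ_[p] D, @IsClosed D (padicTop p D) (M : Set D) →
      ∃ (G : Group (boldPMul p M)) (S : Subgroup Dˣ),
        IsBCHGroup p M G ∧
        ((fun s : Dˣ => (s : D)) '' (S : Set Dˣ)) =
          {u : D | ∃ a ∈ boldPMul p M, IsExp p (a : D) u} ∧
        ∃ φ : boldPMul p M ≃* S,
          ∀ a : boldPMul p M, IsExp p ((a : M) : D) ((φ a : Dˣ) : D)) := by
  let φ : D →ₐ[ℤ_[p]] ℚ_[p] ⊗[ℤ_[p]] D := Algebra.TensorProduct.includeRight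
  have hφ : Function.Injective φ :=
    Algebra.TensorProduct.includeRight_injective (FaithfulSMul.algebraMap_injective ℤ_[p] ℚ_[p])
  refine ⟨fun a ha => ?_, fun a ha => ⟨fun u => isLog_of_isExp hφ ha,
    fun v => isExp_of_isLog hφ ha, isExp_one_iff hφ ha⟩, exists_bchGroup hφ⟩
  obtain ⟨u, hu1, hu⟩ := exists_hasEval_formalExp (φ := φ) ha
  obtain ⟨v, hv1, hv⟩ := exists_hasEval_logOneAdd (φ := φ) ha
  have hu' := (isExp_iff_hasEval hφ ha).2 hu
  have hv' := (isLog_iff_hasEval hφ ha).2 hv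
  exact ⟨exists_isExpTerms hφ ha, ⟨u, hu', fun _ h => h.unique hφ hu'⟩,
    fun _ h => h.unique hφ hu' ▸ hu1, ⟨v, hv', fun _ h => h.unique hφ hv'⟩,
    fun _ h => h.unique hφ hv' ▸ hv1⟩
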